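/- Let $\mathcal H$ be a complex Hilbert space, with inner product $\langle\cdot,\cdot\rangle$ linear in the first argument, and let $\{\psi_n\}_{n\in\mathbb Z}\subset\mathcal H$ be unit vectors such that $\langle\psi_{n+1},\psi_{m+1}\rangle=\langle\psi_n,\psi_m\rangle$ for all $n,m\in\mathbb Z$ and such that the Gram matrix $G=\{\langle\psi_n,\psi_m\rangle\}_{n,m\in\mathbb Z}$ is a bounded operator on $\ell^2(\mathbb Z)$. Put $\widehat\varphi_m=\langle\psi_m,\psi_0\rangle$ (the Fourier coefficients of the symbol $\varphi(k)=\sum_m\widehat\varphi_m e^{imk}$). Let $\mathbf P_0$ be a probability measure on $\mathbb R$ with compact support contained in $(0,\infty)$, and let $\varkappa=\{\varkappa_n\}_{n\in\mathbb Z}$ be i.i.d. with distribution $\mathbf P_0$, i.e. $\varkappa\in\Omega=\mathbb R^{\mathbb Z}$ with the product measure $\mathbf P=\prod_{n\in\mathbb Z}\mathbf P_0$, with expectation $\mathbf E$ and variance $\mathbf V$. Let $$\mathcal P_\varkappa^{(N)}=\sum_{n=-N}^N\varkappa_n\langle\cdot,\psi_n\rangle\psi_n .$$ (0) Almost surely,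 and also for the constant sequence $\varkappa\equiv1$, the operators $\mathcal P_\varkappa^{(N)}$ converge strongly as $N\to\infty$ to a bounded operator $\mathcal P_\varkappa$ (written $\mathcal P_1$ if $\varkappa\equiv1$). Moreover there are a non-random set $\Sigma\subset\mathbb R$ and a non-random probability measure $\nu$ on $[0,\infty)$ with the following properties. (i) Almost surely $\sigma(\mathcal P_\varkappa)=\Sigma$ (the deterministic spectrum). One has $\operatorname{supp}\nu\setminus\{0\}=\Sigma\setminus\{0\}$, and $0\in\operatorname{supp}\nu$ if and only if $0\in\sigma(G)$. If the kernels of $\mathcal P_1$ and of $G$ are both trivial or both non-trivial (as is the case for the realisation $\psi_n(k)=\sqrt{\varphi(k)}\,e^{ink}$ in $L^2(\mathbb T)$), then $\operatorname{supp}\nu=\Sigma$. (ii) Every continuous $f:\mathbb R\to\mathbb R$ is $\nu$-integrable, and there is a set $\Omega_*\subset\Omega$ of full measure such that for every $\varkappa\in\Omega_*$ and every continuous $f:\mathbb R\to\mathbb R$ $$\lim_{N\to\infty}\frac1{2N+1}\operatorname{Tr}f\bigl(\mathcal P_\varkappa^{(N)}|_{\operatorname{Ran}\mathcal P_\varkappa^{(N)}}\bigr)=\lim_{N\to\infty}\int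 f\,d\nu^{(N)}_{\mathcal P_\varkappa}=\int_0^\infty f\,d\nu ,$$ where $\nu^{(N)}_{\mathcal P_\varkappa}$ is the measure with a point mass $1/(2N+1)$ at each non-zero eigenvalue of $\mathcal P_\varkappa^{(N)}$, counted with multiplicity. (iii) $\mathbf E\{\varkappa_0^2\}<\infty$, $\sum_m|\widehat\varphi_m|^2<\infty$, and $$\int_0^\infty\lambda\,d\nu(\lambda)=\mathbf E\{\varkappa_0\},\qquad \int_0^\infty\lambda^2\,d\nu(\lambda)=\mathbf V\{\varkappa_0\}+(\mathbf E\{\varkappa_0\})^2\sum_{m=-\infty}^\infty|\widehat\varphi_m|^2 .$$ -/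

import Mathlib

open MeasureTheory ProbabilityTheory Filter Topology
open scoped ENNReal

noncomputable section

namespace ProjSum

/-- The Hilbert space `ℓ²(ℤ)` of complex sequences. -/
abbrev EllTwo : Type := lp (fun _ : ℤ => ℂ) 2

variable {H : Type*} [NormedAddCommGroup H] [InnerProductSpace ℂ H]

/-- The bounded operator `G` on `ℓ²(ℤ)` has the Gram matrix `⟨ψ_n, ψ_m⟩` in the canonical basis.
The inner product `⟨x, y⟩` that is linear in `x` is `inner ℂ y x` in Mathlib. -/
def IsGramOperator (ψ : ℤ → H) (G : EllTwo →L[ℂ] EllTwo) : Prop :=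
  ∀ n m : ℤ, (G (lp.single 2 m (1 : ℂ)) : ℤ → ℂ) n = inner ℂ (ψ m) (ψ n)

/-- The Fourier coefficient `⟨ψ_m, ψ_0⟩` of the symbol. -/
def symbolCoeff (ψ : ℤ → H) (m : ℤ) : ℂ := inner ℂ (ψ 0) (ψ m)

/-- The finite-rank operator `∑_{|n| ≤ N} κ_n ⟨·, ψ_n⟩ ψ_n`. -/
def finOp (ψ : ℤ → H) (κ : ℤ → ℝ) (N : ℕ) : H →L[ℂ] H :=
  ∑ n ∈ Finset.Icc (-(N : ℤ)) (N : ℤ), (κ n : ℂ) • InnerProductSpace.rankOne ℂ (ψ n) (ψ n)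

open Classical in
/-- The operator `∑_{n ∈ ℤ} κ_n ⟨·, ψ_n⟩ ψ_n`: the strong limit of `finOp ψ κ N` as `N → ∞`
(and `0` if there is no bounded strong limit). -/
def limOp (ψ : ℤ → H) (κ : ℤ → ℝ) : H →L[ℂ] H :=
  if h : ∃ T : H →L[ℂ] H, ∀ x, Tendsto (fun N : ℕ => finOp ψ κ N x) atTop (𝓝 (T x))
  then h.choose else 0

/-- The range of `finOp ψ κ N`. -/
abbrev finRan (ψ : ℤ → H) (κ : ℤ → ℝ) (N : ℕ) : Submodule ℂ H :=
  LinearMap.range (finOp ψ κ N : H →ₗ[ℂ] H)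

theorem finRan_le_span (ψ : ℤ → H) (κ : ℤ → ℝ) (N : ℕ) :
    finRan ψ κ N ≤
      Submodule.span ℂ (ψ '' (Finset.Icc (-(N : ℤ)) (N : ℤ) : Finset ℤ)) := by
  rintro _ ⟨x, rfl⟩
  simp only [finOp, ContinuousLinearMap.coe_coe, sum_apply,
    smul_apply, InnerProductSpace.rankOne_apply]
  refine Submodule.sum_mem _ fun n hn => ?_
  refine Submodule.smul_mem _ _ (Submodule.smul_mem _ _ (Submodule.subset_span ⟨n, ?_, rfl⟩))
  exact_mod_cast hn

instance finRan_finiteDimensional (ψ : ℤ → H) (κ : ℤ → ℝ) (N : ℕ) :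
    FiniteDimensional ℂ (finRan ψ κ N) :=
  haveI : FiniteDimensional ℂ
      (Submodule.span ℂ (ψ '' (Finset.Icc (-(N : ℤ)) (N : ℤ) : Finset ℤ))) :=
    FiniteDimensional.span_of_finite ℂ ((Finset.finite_toSet _).image ψ)
  Submodule.finiteDimensional_of_le (finRan_le_span ψ κ N)

instance finRan_completeSpace (ψ : ℤ → H) (κ : ℤ → ℝ) (N : ℕ) :
    CompleteSpace (finRan ψ κ N) :=
  FiniteDimensional.complete ℂ (finRan ψ κ N)

/-- The restriction of `finOp ψ κ N` to its range. -/
def finOpRan (ψ : ℤ → H) (κ : ℤ → ℝ) (N : ℕ) : finRan ψ κ N →L[ℂ] finRan ψ κ N :=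
  ((finOp ψ κ N).comp (finRan ψ κ N).subtypeL).codRestrict (finRan ψ κ N)
    (fun x => LinearMap.mem_range_self (finOp ψ κ N : H →ₗ[ℂ] H) (x : H))

/-- The restricted operator is self-adjoint, so that its continuous functional calculus `cfc` is
the genuine one. -/
theorem finOpRan_isSelfAdjoint (ψ : ℤ → H) (κ : ℤ → ℝ) (N : ℕ) :
    IsSelfAdjoint (finOpRan ψ κ N) := by
  rw [ContinuousLinearMap.isSelfAdjoint_iff_isSymmetric]
  intro x y
  change inner ℂ (finOp ψ κ N (x : H)) (y : H) = inner ℂ (x : H) (finOp ψ κ N (y : H))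
  simp only [finOp, sum_apply, smul_apply,
    InnerProductSpace.rankOne_apply, sum_inner, inner_sum, inner_smul_left, inner_smul_right,
    Complex.conj_ofReal, inner_conj_symm]
  exact Finset.sum_congr rfl fun n _ => by ring

/-- `Tr f(A)` for a self-adjoint operator `A` on a finite-dimensional space, where `f(A)` is given
by the continuous functional calculus. -/
def traceFun {E : Type*} [NormedAddCommGroup E] [InnerProductSpace ℂ E] [CompleteSpace E]
    (A : E →L[ℂ] E) (f : ℝ → ℝ) : ℂ :=
  LinearMap.trace ℂ E ((cfc f A : E →L[ℂ] E) : E →ₗ[ℂ] E)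

/-- `(2N+1)⁻¹ Tr f(A)`, where `A` is the restriction of `finOp ψ κ N` to its range. -/
def normTrace (ψ : ℤ → H) (κ : ℤ → ℝ) (N : ℕ) (f : ℝ → ℝ) : ℂ :=
  (2 * (N : ℂ) + 1)⁻¹ * traceFun (finOpRan ψ κ N) f

/-- The normalised eigenvalue counting measure: a point mass `1/(2N+1)` at each non-zero eigenvalue
of `finOp ψ κ N`, counted with multiplicity. -/
def countMeasure (ψ : ℤ → H) (κ : ℤ → ℝ) (N : ℕ) : Measure ℝ :=
  (2 * (N : ℝ≥0∞) + 1)⁻¹ • Measure.sum fun t : {t : ℝ // t ≠ 0} =>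
    (Module.finrank ℂ (Module.End.eigenspace (finOp ψ κ N : H →ₗ[ℂ] H) ((t : ℝ) : ℂ)) : ℝ≥0∞) •
      Measure.dirac (t : ℝ)

end ProjSum

end

/-! Let `T` be the analysis operator `y ↦ (⟨y, ψ_n⟩)_n`, bounded because the Gram matrix is, and let
`D` be multiplication by `√κ_n` on `ℓ²(ℤ)`. The operator under study is `(DT)*(DT)` (`sumOp`). Its
companion `(DT)(DT)*` (`gramOp`) acts on `ℓ²(ℤ)` with matrix `√κ_n √κ_m ⟨ψ_m, ψ_n⟩`, and the two
have the same spectrum away from 0 (`mem_spectrum_comp_iff`). Translating `κ` translates this matrix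
(`gramOp_pow_shiftSeq`), so the companion is an ergodic operator. The measure `ν` is its density of
states: the expectation of its spectral measure at the basis vector `e_0`
(`exists_average_spectralMeasure`).

After restriction to `κ_n ∈ [0, b]` the sample space is compact, and the diagonal elements of
`f(gramOp)` along `ℤ` are one continuous function `F` evaluated along translates of `κ`. Up to `ε`,
`F` depends on finitely many coordinates, so the ergodic theorem reduces to the strong law of large
numbers (`ae_tendsto_average`). Testing with countably many tent functions identifies `supp ν` with
the almost sure spectrum of the companion (`spectrum_eq_support`).

The finite sums are the same operators for `κ` cut off outside `[-N, N]`. The trace of a positive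
power is a sum of diagonal elements of the companion over `[-N, N]` (`sum_finEigenvalues_pow`), and
the cutoff is felt only near the edges (`tendsto_average_truncate`). The zeroth power requires rank
`2N+1`, that is, linear independence of the `ψ_n`. Weierstrass approximation passes from moments to
continuous functions.

At 0 the sequence `κ`, being bounded away from 0, plays no role: 0 lies in the spectrum of the
companion iff `T*` is not bounded below, iff `0 ∈ σ(G)`; it lies in that of the sum iff `T` is not
bounded below. If the kernels of `T` and `T*` are both trivial or both non-trivial, these conditions
agree. The two moment formulas are the expectations of the corner elements of the companion and of
its square. -/

noncomputable section

namespace ProjSum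

/-! ### The analysis operator and the factorisations `S*S` and `SS*` -/

section

open ContinuousLinearMap

variable {H : Type*} [NormedAddCommGroup H] [InnerProductSpace ℂ H]

/-- The standard basis vector of `ℓ²(ℤ)`. -/
abbrev stdVec (n : ℤ) : EllTwo := lp.single 2 n (1 : ℂ)

/-- `T` is the analysis operator `x ↦ (⟨x, ψ_n⟩)_n` of the family `ψ`. -/
def IsAnalysis (ψ : ℤ → H) (T : H →L[ℂ] EllTwo) : Prop :=
  ∀ x n, T x n = inner ℂ (ψ n) x

theorem inner_stdVec_left (n : ℤ) (c : EllTwo) : inner ℂ (stdVec n) c = c n := by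
  rw [lp.inner_single_left]; simp

theorem norm_stdVec (n : ℤ) : ‖stdVec n‖ = 1 := by
  rw [lp.norm_single (by norm_num)]; simp

theorem hasSum_stdVec (c : EllTwo) : HasSum (fun n => c n • stdVec n) c := by
  have h := lp.hasSum_single (p := 2) (by norm_num) c
  convert h using 2 with n
  rw [← lp.single_smul]; simp

/-- The left side is the quadratic form of `G` at the vector with coordinates `conj (c n)`. The
conjugates appear because `G` is the transpose of the matrix of `T T*`. -/
theorem norm_sq_sum_le {ψ : ℤ → H} {G : EllTwo →L[ℂ] EllTwo} (hG : IsGramOperator ψ G)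
    (s : Finset ℤ) (c : ℤ → ℂ) :
    ‖∑ n ∈ s, c n • ψ n‖ ^ 2 ≤ ‖G‖ * ∑ n ∈ s, ‖c n‖ ^ 2 := by
  set d : EllTwo := ∑ n ∈ s, (starRingEnd ℂ (c n)) • stdVec n with hd
  have hdn : ‖d‖ ^ 2 = ∑ n ∈ s, ‖c n‖ ^ 2 := by
    have h := lp.norm_sum_single (E := fun _ : ℤ => ℂ) (p := 2) (by norm_num)
      (fun n => starRingEnd ℂ (c n)) s
    have h2 : d = ∑ n ∈ s, lp.single 2 n (starRingEnd ℂ (c n)) := by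
      rw [hd]
      refine Finset.sum_congr rfl fun n _ => ?_
      rw [← lp.single_smul]; simp
    rw [h2]
    simpa using h
  have h1 : inner ℂ d (G d) = ((‖∑ n ∈ s, c n • ψ n‖ ^ 2 : ℝ) : ℂ) := by
    have hsq : ((‖∑ n ∈ s, c n • ψ n‖ ^ 2 : ℝ) : ℂ) =
        inner ℂ (∑ n ∈ s, c n • ψ n) (∑ n ∈ s, c n • ψ n) := by
      rw [inner_self_eq_norm_sq_to_K]; norm_cast
    rw [hsq, hd, map_sum]
    simp only [sum_inner, inner_sum, map_smul, inner_smul_left, inner_smul_right,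
      inner_stdVec_left, hG _ _, Complex.conj_conj,
      Finset.mul_sum]
    rw [Finset.sum_comm]
    refine Finset.sum_congr rfl fun m _ => Finset.sum_congr rfl fun n _ => by ring
  have h2 : ‖(inner ℂ d (G d) : ℂ)‖ ≤ ‖G‖ * ‖d‖ ^ 2 := by
    refine (norm_inner_le_norm _ _).trans ?_
    have := G.le_opNorm d
    nlinarith [norm_nonneg d]
  rw [h1, hdn, Complex.norm_real, Real.norm_of_nonneg (by positivity)] at h2
  exact h2

/-- Bessel bound by duality. With `y = ∑ ⟨x, ψ_n⟩ ψ_n`, the sum `S` equals `⟨x, y⟩`, and `‖y‖² ≤ ‖G‖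
S`; hence `S² ≤ ‖G‖ ‖x‖² S`. -/
theorem sum_norm_inner_sq_le {ψ : ℤ → H} {G : EllTwo →L[ℂ] EllTwo} (hG : IsGramOperator ψ G)
    (s : Finset ℤ) (x : H) : ∑ n ∈ s, ‖inner ℂ (ψ n) x‖ ^ 2 ≤ ‖G‖ * ‖x‖ ^ 2 := by
  set S := ∑ n ∈ s, ‖inner ℂ (ψ n) x‖ ^ 2 with hS
  have hS0 : 0 ≤ S := Finset.sum_nonneg fun _ _ => by positivity
  set y := ∑ n ∈ s, (inner ℂ (ψ n) x : ℂ) • ψ n with hy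
  have h1 : (inner ℂ y x : ℂ) = (S : ℂ) := by
    rw [hy, sum_inner, hS]
    push_cast
    refine Finset.sum_congr rfl fun n _ => ?_
    rw [inner_smul_left, Complex.conj_mul']
  have h2 : S ≤ ‖y‖ * ‖x‖ := by
    have := norm_inner_le_norm (𝕜 := ℂ) y x
    rwa [h1, Complex.norm_real, Real.norm_of_nonneg hS0] at this
  have h3 : ‖y‖ ^ 2 ≤ ‖G‖ * S := norm_sq_sum_le hG s _
  by_contra hlt
  push Not at hlt
  have hpos : 0 < S := lt_of_le_of_lt (by positivity) hlt
  have h4 : S ^ 2 ≤ ‖y‖ ^ 2 * ‖x‖ ^ 2 := by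
    rw [← mul_pow]; exact pow_le_pow_left₀ hS0 h2 2
  have h5 : S ^ 2 ≤ S * (‖G‖ * ‖x‖ ^ 2) := by nlinarith [sq_nonneg ‖x‖]
  nlinarith

theorem exists_isAnalysis {ψ : ℤ → H} {G : EllTwo →L[ℂ] EllTwo} (hG : IsGramOperator ψ G) :
    ∃ T : H →L[ℂ] EllTwo, IsAnalysis ψ T := by
  have hmem : ∀ x : H, Memℓp (fun n : ℤ => (inner ℂ (ψ n) x : ℂ)) 2 := fun x => by
    refine memℓp_gen' (C := ‖G‖ * ‖x‖ ^ 2) fun s => ?_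
    simpa using sum_norm_inner_sq_le hG s x
  refine ⟨LinearMap.mkContinuous
    { toFun := fun x => (⟨_, hmem x⟩ : EllTwo)
      map_add' := fun x y => by
        ext n
        exact inner_add_right (𝕜 := ℂ) (ψ n) x y
      map_smul' := fun c x => by
        ext n
        exact inner_smul_right (𝕜 := ℂ) (ψ n) x c } (Real.sqrt ‖G‖) fun x => ?_,
    fun x n => rfl⟩
  refine lp.norm_le_of_forall_sum_le (p := 2) (by norm_num) (by positivity) fun s => ?_
  rw [show ((Real.sqrt ‖G‖ * ‖x‖) ^ (2 : ℝ≥0∞).toReal) = ‖G‖ * ‖x‖ ^ 2 by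
    simp [mul_pow]]
  simpa using sum_norm_inner_sq_le hG s x

variable [CompleteSpace H]

theorem IsAnalysis.adjoint_stdVec {ψ : ℤ → H} {T : H →L[ℂ] EllTwo} (hT : IsAnalysis ψ T) (n : ℤ) :
    adjoint T (stdVec n) = ψ n := by
  refine ext_inner_right ℂ fun x => ?_
  rw [adjoint_inner_left, inner_stdVec_left, hT]

/-- Multiplication by the square root of a bounded non-negative sequence on `ℓ²(ℤ)`. -/
def diagOp {b : ℝ} (x : ℤ → Set.Icc (0 : ℝ) b) : EllTwo →L[ℂ] EllTwo :=
  lp.mapCLM (E := fun _ : ℤ => ℂ) (F := fun _ : ℤ => ℂ) 2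
    (fun n => ((Real.sqrt (x n) : ℝ) : ℂ) • ContinuousLinearMap.id ℂ ℂ)
    (Real.sqrt_nonneg b) (fun n => by
      refine (norm_smul_le _ _).trans ?_
      rw [Complex.norm_real, Real.norm_of_nonneg (Real.sqrt_nonneg _), norm_id, mul_one]
      exact Real.sqrt_le_sqrt (x n).2.2)

variable {b : ℝ} (x : ℤ → Set.Icc (0 : ℝ) b)

@[simp]
theorem diagOp_apply (c : EllTwo) (n : ℤ) : diagOp x c n = (Real.sqrt (x n) : ℂ) * c n := by
  simp [diagOp]

theorem norm_diagOp_le : ‖diagOp x‖ ≤ Real.sqrt b := lp.norm_mapCLM_le _ _ _ _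

theorem diagOp_stdVec (n : ℤ) : diagOp x (stdVec n) = (Real.sqrt (x n) : ℂ) • stdVec n := by
  ext m
  simp only [diagOp_apply, lp.coeFn_smul, Pi.smul_apply, smul_eq_mul]
  rcases eq_or_ne m n with rfl | h
  · rfl
  · simp [h]

theorem adjoint_diagOp : adjoint (diagOp x) = diagOp x := by
  symm
  rw [eq_adjoint_iff]
  intro c d
  rw [lp.inner_eq_tsum, lp.inner_eq_tsum]
  refine tsum_congr fun n => ?_
  simp only [diagOp_apply, RCLike.inner_apply, map_mul, Complex.conj_ofReal]
  ring

/-- The operator on `ℓ²(ℤ)` with matrix `√x_n √x_m ⟨ψ_m, ψ_n⟩`. -/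
def gramOp (T : H →L[ℂ] EllTwo) : EllTwo →L[ℂ] EllTwo :=
  (diagOp x ∘L T) ∘L adjoint (diagOp x ∘L T)

/-- The operator `∑ x_n ⟨·, ψ_n⟩ ψ_n`, with `T` the analysis operator of `ψ`. -/
def sumOp (T : H →L[ℂ] EllTwo) : H →L[ℂ] H :=
  adjoint (diagOp x ∘L T) ∘L (diagOp x ∘L T)

theorem gramOp_apply (T : H →L[ℂ] EllTwo) (c : EllTwo) :
    gramOp x T c = diagOp x (T (adjoint T (diagOp x c))) := by
  simp [gramOp, adjoint_comp, adjoint_diagOp]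

theorem isSelfAdjoint_gramOp (T : H →L[ℂ] EllTwo) : IsSelfAdjoint (gramOp x T) :=
  IsSelfAdjoint.conj_adjoint (IsSelfAdjoint.one _ : IsSelfAdjoint (1 : H →L[ℂ] H)) (diagOp x ∘L T)

theorem norm_gramOp_le (T : H →L[ℂ] EllTwo) (hb : 0 ≤ b) : ‖gramOp x T‖ ≤ b * ‖T‖ ^ 2 := by
  have h1 : ‖diagOp x ∘L T‖ ≤ Real.sqrt b * ‖T‖ :=
    (opNorm_comp_le _ _).trans (mul_le_mul_of_nonneg_right (norm_diagOp_le x) (norm_nonneg _))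
  refine (opNorm_comp_le _ _).trans ?_
  rw [LinearIsometryEquiv.norm_map]
  calc _ ≤ (Real.sqrt b * ‖T‖) * (Real.sqrt b * ‖T‖) :=
        mul_le_mul h1 h1 (norm_nonneg _) (by positivity)
    _ = _ := by rw [mul_mul_mul_comm, Real.mul_self_sqrt hb, sq]

theorem norm_sumOp_le (T : H →L[ℂ] EllTwo) (hb : 0 ≤ b) : ‖sumOp x T‖ ≤ b * ‖T‖ ^ 2 := by
  have h1 : ‖diagOp x ∘L T‖ ≤ Real.sqrt b * ‖T‖ :=
    (opNorm_comp_le _ _).trans (mul_le_mul_of_nonneg_right (norm_diagOp_le x) (norm_nonneg _))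
  refine (opNorm_comp_le _ _).trans ?_
  rw [LinearIsometryEquiv.norm_map]
  calc _ ≤ (Real.sqrt b * ‖T‖) * (Real.sqrt b * ‖T‖) :=
        mul_le_mul h1 h1 (norm_nonneg _) (by positivity)
    _ = _ := by rw [mul_mul_mul_comm, Real.mul_self_sqrt hb, sq]

/-- Cut a sequence off outside `[-N, N]`. -/
def truncate (hb : 0 ≤ b) (N : ℕ) (x : ℤ → Set.Icc (0 : ℝ) b) : ℤ → Set.Icc (0 : ℝ) b :=
  fun n => if n ∈ Finset.Icc (-(N : ℤ)) N then x n else ⟨0, le_rfl, hb⟩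

theorem hasSum_sumOp {ψ : ℤ → H} {T : H →L[ℂ] EllTwo} (hT : IsAnalysis ψ T) (y : H) :
    HasSum (fun n => ((x n : ℝ) : ℂ) • InnerProductSpace.rankOne ℂ (ψ n) (ψ n) y)
      (sumOp x T y) := by
  have h := (hasSum_stdVec (diagOp x (diagOp x (T y)))).mapL (adjoint T)
  have h2 : adjoint T (diagOp x (diagOp x (T y))) = sumOp x T y := by
    simp [sumOp, adjoint_comp, adjoint_diagOp]
  rw [h2] at h
  convert h using 2 with n
  rw [map_smul, hT.adjoint_stdVec, diagOp_apply, diagOp_apply, hT, ← mul_assoc,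
    ← Complex.ofReal_mul, Real.mul_self_sqrt (x n).2.1, InnerProductSpace.rankOne_apply, mul_smul]

/-- Places the finite sums in the same family as the limit operator. The cutoff value 0 is why
sequences range over `[0, b]` and not over an interval away from 0. -/
theorem sumOp_truncate {ψ : ℤ → H} {T : H →L[ℂ] EllTwo} (hT : IsAnalysis ψ T) (hb : 0 ≤ b)
    (N : ℕ) {κ : ℤ → ℝ} (hκ : ∀ n, κ n = x n) : sumOp (truncate hb N x) T = finOp ψ κ N := by
  ext y
  refine (hasSum_sumOp (truncate hb N x) hT y).unique ?_
  have : finOp ψ κ N y = ∑ n ∈ Finset.Icc (-(N : ℤ)) N,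
      ((truncate hb N x n : ℝ) : ℂ) • InnerProductSpace.rankOne ℂ (ψ n) (ψ n) y := by
    simp only [finOp, sum_apply, smul_apply]
    refine Finset.sum_congr rfl fun n hn => ?_
    rw [truncate, if_pos hn, hκ]
  rw [this]
  refine hasSum_sum_of_ne_finset_zero fun n hn => ?_
  rw [truncate, if_neg hn]
  simp

theorem tendsto_Icc_neg_atTop :
    Tendsto (fun N : ℕ => Finset.Icc (-(N : ℤ)) (N : ℤ)) atTop atTop := by
  refine tendsto_atTop_finset_of_monotone (fun M N h => Finset.Icc_subset_Icc ?_ ?_) fun n =>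
    ⟨n.natAbs, ?_⟩
  · simpa using h
  · simpa using h
  · rw [Finset.mem_Icc]; omega

theorem tendsto_finOp {ψ : ℤ → H} {T : H →L[ℂ] EllTwo} (hT : IsAnalysis ψ T)
    {κ : ℤ → ℝ} (hκ : ∀ n, κ n = x n) (y : H) :
    Tendsto (fun N : ℕ => finOp ψ κ N y) atTop (𝓝 (sumOp x T y)) := by
  have h := (hasSum_sumOp x hT y).comp tendsto_Icc_neg_atTop
  refine h.congr fun N => ?_
  simp only [finOp, sum_apply, smul_apply, Function.comp, hκ]

theorem limOp_eq {ψ : ℤ → H} {T : H →L[ℂ] EllTwo} (hT : IsAnalysis ψ T)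
    {κ : ℤ → ℝ} (hκ : ∀ n, κ n = x n) : limOp ψ κ = sumOp x T := by
  have hex : ∃ S : H →L[ℂ] H, ∀ y, Tendsto (fun N : ℕ => finOp ψ κ N y) atTop (𝓝 (S y)) :=
    ⟨_, tendsto_finOp x hT hκ⟩
  rw [limOp, dif_pos hex]
  ext y
  exact tendsto_nhds_unique (hex.choose_spec y) (tendsto_finOp x hT hκ y)

end

/-! ### Invertibility, the spectrum away from 0, and the point 0 -/

section

open ContinuousLinearMap

section Abstract

variable {E F : Type*} [NormedAddCommGroup E] [InnerProductSpace ℂ E] [CompleteSpace E]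
  [NormedAddCommGroup F] [InnerProductSpace ℂ F] [CompleteSpace F]

/-- `S` is bounded from below. -/
def IsBddBelowOp (S : E →L[ℂ] F) : Prop := ∃ c : ℝ, 0 < c ∧ ∀ x, ‖x‖ ≤ c * ‖S x‖

/-- Since `⟨S*S x, x⟩ = ‖S x‖²`, a lower bound on `S` is coercivity of `S*S`. -/
theorem isUnit_adjoint_comp_self_iff (S : E →L[ℂ] F) :
    IsUnit (adjoint S ∘L S) ↔ IsBddBelowOp S := by
  constructor
  · rintro ⟨u, hu⟩
    refine ⟨‖(u⁻¹ : (E →L[ℂ] E)ˣ).val ∘L adjoint S‖ + 1, by positivity, fun x => ?_⟩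
    have h : ((u⁻¹ : (E →L[ℂ] E)ˣ).val ∘L adjoint S) (S x) = x := by
      have := congrArg (fun A : E →L[ℂ] E => A x) u.inv_mul
      rw [hu] at this
      simpa using this
    calc ‖x‖ = ‖((u⁻¹ : (E →L[ℂ] E)ˣ).val ∘L adjoint S) (S x)‖ := by rw [h]
      _ ≤ _ := le_opNorm _ _
      _ ≤ _ := mul_le_mul_of_nonneg_right (by linarith) (norm_nonneg _)
  · rintro ⟨c, hc, h⟩
    refine isUnit_of_forall_le_norm_inner_map _ (c := ((c ^ 2)⁻¹).toNNReal)
      (by rw [Real.toNNReal_pos]; positivity) fun x => ?_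
    rw [coe_comp, Function.comp_apply, adjoint_inner_left, inner_self_eq_norm_sq_to_K]
    have h2 : ‖x‖ ^ 2 ≤ c ^ 2 * ‖S x‖ ^ 2 := by
      rw [← mul_pow]; exact pow_le_pow_left₀ (norm_nonneg _) (h x) 2
    simp only [norm_pow, RCLike.norm_ofReal, abs_norm]
    rw [Real.coe_toNNReal _ (by positivity), mul_inv_le_iff₀ (by positivity)]
    linarith

theorem isUnit_comp_adjoint_self_iff (S : E →L[ℂ] F) :
    IsUnit (S ∘L adjoint S) ↔ IsBddBelowOp (adjoint S) := by
  have := isUnit_adjoint_comp_self_iff (adjoint S)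
  rwa [adjoint_adjoint] at this

/-- `S* (S (S*S)⁻¹ S* y - y) = 0`, so injectivity of `S*` makes `S (S*S)⁻¹` a bounded left inverse
of `S*`. -/
theorem IsBddBelowOp.adjoint {S : E →L[ℂ] F} (h : IsBddBelowOp S)
    (hker : ∀ y, ContinuousLinearMap.adjoint S y = 0 → y = 0) :
    IsBddBelowOp (ContinuousLinearMap.adjoint S) := by
  obtain ⟨u, hu⟩ := (isUnit_adjoint_comp_self_iff S).2 h
  refine ⟨‖S ∘L (u⁻¹ : (E →L[ℂ] E)ˣ).val‖ + 1, by positivity, fun y => ?_⟩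
  have h1 : (S ∘L (u⁻¹ : (E →L[ℂ] E)ˣ).val) (ContinuousLinearMap.adjoint S y) = y := by
    rw [← sub_eq_zero]
    refine hker _ ?_
    have := congrArg (fun A : E →L[ℂ] E => A (ContinuousLinearMap.adjoint S y)) u.mul_inv
    rw [hu] at this
    rw [map_sub, sub_eq_zero]
    simpa using this
  calc ‖y‖ = ‖(S ∘L (u⁻¹ : (E →L[ℂ] E)ˣ).val) (ContinuousLinearMap.adjoint S y)‖ := by rw [h1]
    _ ≤ _ := le_opNorm _ _
    _ ≤ _ := mul_le_mul_of_nonneg_right (by linarith) (norm_nonneg _)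

omit [CompleteSpace E] [CompleteSpace F] in
theorem IsBddBelowOp.eq_zero {S : E →L[ℂ] F} (h : IsBddBelowOp S) {x : E} (hx : S x = 0) :
    x = 0 := by
  obtain ⟨c, -, h⟩ := h
  simpa [hx] using h x

theorem apply_eq_zero_of_adjoint_apply_eq_zero {S : E →L[ℂ] F} {x : E}
    (h : adjoint S (S x) = 0) : S x = 0 := by
  rw [← inner_self_eq_zero (𝕜 := ℂ), ← adjoint_inner_left, h, inner_zero_left]

omit [CompleteSpace E] [CompleteSpace F] in
-- The inverse is explicit: `(z - BA)⁻¹ = z⁻¹ (1 + B (z - AB)⁻¹ A)`.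
theorem isUnit_sub_comp_of_isUnit {A : E →L[ℂ] F} {B : F →L[ℂ] E} {z : ℂ} (hz : z ≠ 0)
    (h : IsUnit (algebraMap ℂ (F →L[ℂ] F) z - A ∘L B)) :
    IsUnit (algebraMap ℂ (E →L[ℂ] E) z - B ∘L A) := by
  obtain ⟨u, hu⟩ := h
  set R := (u⁻¹ : (F →L[ℂ] F)ˣ).val
  have h1 : ∀ y, z • R y - A (B (R y)) = y := fun y => by
    have := congrArg (fun C : F →L[ℂ] F => C y) u.mul_inv
    rw [hu] at this
    simpa [Algebra.algebraMap_eq_smul_one] using this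
  have h2 : ∀ y, R (z • y - A (B y)) = y := fun y => by
    have := congrArg (fun C : F →L[ℂ] F => C y) u.inv_mul
    rw [hu] at this
    simpa [Algebra.algebraMap_eq_smul_one] using this
  refine ⟨⟨_, z⁻¹ • (1 + B ∘L R ∘L A), ?_, ?_⟩, rfl⟩
  · ext x
    have h := congrArg B (h1 (A x))
    simp only [map_sub, map_smul] at h
    suffices z • z⁻¹ • x + z • z⁻¹ • B (R (A x)) -
        (z⁻¹ • B (A x) + z⁻¹ • B (A (B (R (A x))))) = x by
      simpa [Algebra.algebraMap_eq_smul_one] using this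
    rw [smul_inv_smul₀ hz, smul_inv_smul₀ hz, ← smul_add, ← h, sub_add_cancel, inv_smul_smul₀ hz,
      add_sub_cancel_right]
  · ext x
    have h := congrArg B (h2 (A x))
    simp only [map_sub, map_smul] at h
    suffices z⁻¹ • (z • x - B (A x) + (z • B (R (A x)) - B (R (A (B (A x)))))) = x by
      simpa [Algebra.algebraMap_eq_smul_one] using this
    rw [h, sub_add_cancel, smul_smul, inv_mul_cancel₀ hz, one_smul]

omit [CompleteSpace E] [CompleteSpace F] in
theorem mem_spectrum_comp_iff {A : E →L[ℂ] F} {B : F →L[ℂ] E} {z : ℂ} (hz : z ≠ 0) :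
    z ∈ spectrum ℂ (A ∘L B) ↔ z ∈ spectrum ℂ (B ∘L A) := by
  rw [spectrum.mem_iff, spectrum.mem_iff, not_iff_not]
  exact ⟨isUnit_sub_comp_of_isUnit hz, isUnit_sub_comp_of_isUnit hz⟩

end Abstract

section Diagonal

variable {H : Type*} [NormedAddCommGroup H] [InnerProductSpace ℂ H] [CompleteSpace H]
variable {b : ℝ} {x : ℤ → Set.Icc (0 : ℝ) b}

theorem le_norm_diagOp {a : ℝ} (hx : ∀ n, a ≤ x n) (c : EllTwo) :
    Real.sqrt a * ‖c‖ ≤ ‖diagOp x c‖ := by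
  have h : ‖((Real.sqrt a : ℝ) : ℂ) • c‖ ≤ ‖diagOp x c‖ := by
    refine lp.norm_mono (by norm_num) fun n => ?_
    rw [lp.coeFn_smul, Pi.smul_apply, smul_eq_mul, diagOp_apply, norm_mul, norm_mul,
      Complex.norm_real, Complex.norm_real, Real.norm_of_nonneg (Real.sqrt_nonneg _),
      Real.norm_of_nonneg (Real.sqrt_nonneg _)]
    exact mul_le_mul_of_nonneg_right (Real.sqrt_le_sqrt (hx n)) (norm_nonneg _)
  rwa [norm_smul, Complex.norm_real, Real.norm_of_nonneg (Real.sqrt_nonneg _)] at h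

theorem exists_diagOp_eq {a : ℝ} (ha : 0 < a) (hx : ∀ n, a ≤ x n) (c : EllTwo) :
    ∃ d, diagOp x d = c := by
  have hs : ∀ n, 0 < Real.sqrt (x n) := fun n => Real.sqrt_pos.2 (ha.trans_le (hx n))
  let L : EllTwo →L[ℂ] EllTwo := lp.mapCLM (E := fun _ : ℤ => ℂ) (F := fun _ : ℤ => ℂ) 2
    (fun n => ((Real.sqrt (x n) : ℝ) : ℂ)⁻¹ • ContinuousLinearMap.id ℂ ℂ)
    (K := (Real.sqrt a)⁻¹) (by positivity) (fun n => by
      refine (norm_smul_le _ _).trans ?_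
      rw [norm_inv, Complex.norm_real, Real.norm_of_nonneg (Real.sqrt_nonneg _), norm_id, mul_one]
      exact inv_anti₀ (Real.sqrt_pos.2 ha) (Real.sqrt_le_sqrt (hx n)))
  refine ⟨L c, ?_⟩
  ext n
  have : (Real.sqrt (x n) : ℂ) ≠ 0 := by exact_mod_cast (hs n).ne'
  simp [L, this]

/-- `diagOp x` is bounded above by `√b` and below by `√a`, so it changes only the constant in a
lower bound. -/
theorem isUnit_sumOp_iff {a : ℝ} (ha : 0 < a) (hx : ∀ n, a ≤ x n) (T : H →L[ℂ] EllTwo) :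
    IsUnit (sumOp x T) ↔ IsBddBelowOp T := by
  rw [sumOp, isUnit_adjoint_comp_self_iff]
  have hs := Real.sqrt_pos.2 ha
  constructor
  · rintro ⟨c, hc, h⟩
    refine ⟨c * (Real.sqrt b + 1), by positivity, fun y => (h y).trans ?_⟩
    rw [mul_assoc]
    refine mul_le_mul_of_nonneg_left (((diagOp x).le_opNorm _).trans ?_) hc.le
    exact mul_le_mul_of_nonneg_right ((norm_diagOp_le x).trans (by linarith)) (norm_nonneg _)
  · rintro ⟨c, hc, h⟩
    refine ⟨c / Real.sqrt a, by positivity, fun y => (h y).trans ?_⟩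
    rw [div_mul_eq_mul_div, le_div_iff₀ hs, mul_assoc, mul_comm ‖T y‖]
    exact mul_le_mul_of_nonneg_left (le_norm_diagOp hx _) hc.le

theorem isUnit_gramOp_iff {a : ℝ} (ha : 0 < a) (hx : ∀ n, a ≤ x n) (T : H →L[ℂ] EllTwo) :
    IsUnit (gramOp x T) ↔ IsBddBelowOp (adjoint T) := by
  rw [gramOp, isUnit_comp_adjoint_self_iff, adjoint_comp, adjoint_diagOp]
  have hs := Real.sqrt_pos.2 ha
  constructor
  · rintro ⟨c, hc, h⟩
    refine ⟨c * (Real.sqrt b + 1), by positivity, fun y => ?_⟩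
    obtain ⟨d, rfl⟩ := exists_diagOp_eq ha hx y
    have h1 := h d
    have h2 : ‖diagOp x d‖ ≤ (Real.sqrt b + 1) * ‖d‖ := ((diagOp x).le_opNorm _).trans
      (mul_le_mul_of_nonneg_right ((norm_diagOp_le x).trans (by linarith)) (norm_nonneg _))
    simp only [coe_comp, Function.comp_apply] at h1
    calc _ ≤ _ := h2
      _ ≤ (Real.sqrt b + 1) * (c * ‖adjoint T (diagOp x d)‖) :=
        mul_le_mul_of_nonneg_left h1 (by positivity)
      _ = _ := by ring
  · rintro ⟨c, hc, h⟩
    refine ⟨c / Real.sqrt a, by positivity, fun y => ?_⟩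
    have h1 := h (diagOp x y)
    rw [div_mul_eq_mul_div, le_div_iff₀ hs, mul_comm]
    exact (le_norm_diagOp hx y).trans h1

theorem ext_stdVec {E : Type*} [NormedAddCommGroup E] [NormedSpace ℂ E]
    {A B : EllTwo →L[ℂ] E} (h : ∀ n, A (stdVec n) = B (stdVec n)) : A = B := by
  ext c
  have h1 := (hasSum_stdVec c).mapL A
  have h2 := (hasSum_stdVec c).mapL B
  simp only [map_smul, h] at h1 h2
  exact h1.unique h2

omit [CompleteSpace H] in
theorem inner_shift {ψ : ℤ → H}
    (hshift : ∀ n m : ℤ, inner ℂ (ψ (n + 1)) (ψ (m + 1)) = inner ℂ (ψ n) (ψ m)) (n m k : ℤ) :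
    (inner ℂ (ψ (n + k)) (ψ (m + k)) : ℂ) = inner ℂ (ψ n) (ψ m) := by
  induction k with
  | zero => simp
  | succ k ih => rw [← ih, ← hshift (n + k)]; simp only [add_assoc]
  | pred k ih =>
    rw [← ih, ← hshift (n + (-(k : ℤ) - 1))]
    congr 2 <;> ring

/-- The reflected standard basis is orthonormal, with Gram operator 1; its analysis operator is the
flip, and boundedness comes for free. -/
theorem exists_flip : ∃ V : EllTwo →L[ℂ] EllTwo, ∀ c n, V c n = c (-n) := by
  have hgram : IsGramOperator (fun n : ℤ => stdVec (-n)) (1 : EllTwo →L[ℂ] EllTwo) := by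
    intro n m
    change stdVec m n = _
    rw [inner_stdVec_left]
    rcases eq_or_ne n m with rfl | h
    · simp
    · rw [lp.single_apply_ne _ _ _ h, lp.single_apply_ne]
      simpa using h.symm
  obtain ⟨V, hV⟩ := exists_isAnalysis hgram
  exact ⟨V, fun c n => by rw [hV, inner_stdVec_left]⟩

/-- `G` is the transpose of `T T*`. By translation invariance the matrix is Toeplitz, and
transposing a Toeplitz matrix amounts to reflecting both indices, here by a translation by `n + m`.
-/
theorem exists_gram_eq_conj {ψ : ℤ → H} {G : EllTwo →L[ℂ] EllTwo} (hG : IsGramOperator ψ G)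
    (hshift : ∀ n m : ℤ, inner ℂ (ψ (n + 1)) (ψ (m + 1)) = inner ℂ (ψ n) (ψ m))
    {T : H →L[ℂ] EllTwo} (hT : IsAnalysis ψ T) :
    ∃ V : EllTwo →L[ℂ] EllTwo, V * V = 1 ∧ G = V * (T ∘L adjoint T) * V := by
  obtain ⟨V, hV⟩ := exists_flip
  refine ⟨V, by ext c n; simp [hV], ext_stdVec fun m => ?_⟩
  have hVm : V (stdVec m) = stdVec (-m) := by
    ext n
    rw [hV]
    rcases eq_or_ne (-n) m with rfl | h
    · simp
    · rw [lp.single_apply_ne _ _ _ h, lp.single_apply_ne _ _ _ (by omega)]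
  ext n
  rw [hG, mul_apply_eq_comp, mul_apply_eq_comp, hVm, hV, coe_comp, Function.comp_apply,
    hT.adjoint_stdVec, hT, ← inner_shift hshift (-n) (-m) (n + m)]
  congr 2 <;> ring

theorem isUnit_gram_iff {ψ : ℤ → H} {G : EllTwo →L[ℂ] EllTwo} (hG : IsGramOperator ψ G)
    (hshift : ∀ n m : ℤ, inner ℂ (ψ (n + 1)) (ψ (m + 1)) = inner ℂ (ψ n) (ψ m))
    {T : H →L[ℂ] EllTwo} (hT : IsAnalysis ψ T) : IsUnit G ↔ IsBddBelowOp (adjoint T) := by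
  obtain ⟨V, hVV, rfl⟩ := exists_gram_eq_conj hG hshift hT
  have hVu : IsUnit V := ⟨⟨V, V, hVV, hVV⟩, rfl⟩
  rw [hVu.mul_right_iff, hVu.mul_left_iff, isUnit_comp_adjoint_self_iff]

theorem ker_gram_eq_bot_iff {ψ : ℤ → H} {G : EllTwo →L[ℂ] EllTwo} (hG : IsGramOperator ψ G)
    (hshift : ∀ n m : ℤ, inner ℂ (ψ (n + 1)) (ψ (m + 1)) = inner ℂ (ψ n) (ψ m))
    {T : H →L[ℂ] EllTwo} (hT : IsAnalysis ψ T) :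
    LinearMap.ker (G : EllTwo →ₗ[ℂ] EllTwo) = ⊥ ↔ ∀ c, adjoint T c = 0 → c = 0 := by
  obtain ⟨V, hVV, rfl⟩ := exists_gram_eq_conj hG hshift hT
  have hV : ∀ c, V (V c) = c := fun c => congrArg (fun A : EllTwo →L[ℂ] EllTwo => A c) hVV
  rw [LinearMap.ker_eq_bot']
  constructor
  · intro h c hc
    have := h (V c) (by simp [hV, hc])
    rw [← hV c, this, map_zero]
  · intro h c hc
    have h1 : V (T (adjoint T (V c))) = 0 := by simpa using hc
    have h2 : T (adjoint T (V c)) = 0 := by rw [← hV (T _), h1, map_zero]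
    have h3 : adjoint T (V c) = 0 := by
      refine apply_eq_zero_of_adjoint_apply_eq_zero ?_
      rwa [adjoint_adjoint]
    rw [← hV c, h _ h3, map_zero]

theorem ker_sumOp_eq_bot_iff {a : ℝ} (ha : 0 < a) (hx : ∀ n, a ≤ x n) (T : H →L[ℂ] EllTwo) :
    LinearMap.ker (sumOp x T : H →ₗ[ℂ] H) = ⊥ ↔ ∀ y, T y = 0 → y = 0 := by
  rw [LinearMap.ker_eq_bot']
  refine forall_congr' fun y => imp_congr_left ?_
  have : sumOp x T y = 0 ↔ diagOp x (T y) = 0 :=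
    ⟨fun h => apply_eq_zero_of_adjoint_apply_eq_zero (S := diagOp x ∘L T) h, fun h => by
      simp [sumOp, h]⟩
  rw [coe_coe, this]
  refine ⟨fun h => ?_, fun h => by rw [h, map_zero]⟩
  have := le_norm_diagOp hx (T y)
  rw [h, norm_zero] at this
  have h2 := Real.sqrt_pos.2 ha
  rw [← norm_eq_zero]
  nlinarith [norm_nonneg (T y)]

/-- If the kernels of `T` and its adjoint are both trivial or both non-trivial, then `T` and its
adjoint are simultaneously bounded below. -/
theorem isBddBelowOp_iff_adjoint {T : H →L[ℂ] EllTwo}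
    (h : (∀ y, T y = 0 → y = 0) ↔ ∀ c, adjoint T c = 0 → c = 0) :
    IsBddBelowOp T ↔ IsBddBelowOp (adjoint T) := by
  refine ⟨fun hT => hT.adjoint (h.1 fun y => hT.eq_zero), fun hT => ?_⟩
  have := hT.adjoint (by rw [adjoint_adjoint]; exact h.2 fun y => hT.eq_zero)
  rwa [adjoint_adjoint] at this

end Diagonal

end

/-! ### Continuity and translation covariance of the diagonal elements -/

section

open ContinuousLinearMap Polynomial

variable {H : Type*} [NormedAddCommGroup H] [InnerProductSpace ℂ H] [CompleteSpace H]
variable {b : ℝ}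

/-- In the product topology only strong continuity is available. The series for `‖D_x c - D_{x₀}
c‖²` is dominated by `b |c_n|²` uniformly in `x`, so its termwise continuity carries over to the
sum. -/
theorem continuous_diagOp_apply (c : EllTwo) :
    Continuous fun x : ℤ → Set.Icc (0 : ℝ) b => diagOp x c := by
  have hsum : Summable fun n => ‖c n‖ ^ 2 := by
    have := (lp.memℓp c).summable (by norm_num)
    simpa using this
  rw [continuous_iff_continuousAt]
  intro x₀
  have hnorm : ∀ x : ℤ → Set.Icc (0 : ℝ) b, ‖diagOp x c - diagOp x₀ c‖ ^ 2 =
      ∑' n, (Real.sqrt (x n) - Real.sqrt (x₀ n)) ^ 2 * ‖c n‖ ^ 2 := fun x => by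
    have := lp.norm_rpow_eq_tsum (p := 2) (by norm_num) (diagOp x c - diagOp x₀ c)
    simp only [ENNReal.toReal_ofNat, Real.rpow_ofNat] at this
    rw [this]
    refine tsum_congr fun n => ?_
    rw [lp.coeFn_sub, Pi.sub_apply, diagOp_apply, diagOp_apply, ← sub_mul, norm_mul,
      ← Complex.ofReal_sub, Complex.norm_real, mul_pow, Real.norm_eq_abs, sq_abs]
  have hcont : Continuous fun x : ℤ → Set.Icc (0 : ℝ) b =>
      ∑' n, (Real.sqrt (x n) - Real.sqrt (x₀ n)) ^ 2 * ‖c n‖ ^ 2 := by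
    refine continuous_tsum (u := fun n => Real.sqrt b ^ 2 * ‖c n‖ ^ 2)
      (fun n => by fun_prop) (hsum.mul_left _) fun n x => ?_
    rw [norm_mul, norm_pow, norm_pow, norm_norm]
    refine mul_le_mul_of_nonneg_right (pow_le_pow_left₀ (norm_nonneg _) ?_ 2) (by positivity)
    rw [Real.norm_eq_abs]
    have h1 := Real.sqrt_le_sqrt (x n).2.2
    have h2 := Real.sqrt_le_sqrt (x₀ n).2.2
    have h3 := Real.sqrt_nonneg (x n : ℝ)
    have h4 := Real.sqrt_nonneg (x₀ n : ℝ)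
    exact abs_le.2 ⟨by linarith, by linarith⟩
  have h0 := (hcont.sqrt).tendsto x₀
  simp only [sub_self, ne_eq, OfNat.ofNat_ne_zero, not_false_eq_true, zero_pow, zero_mul,
    tsum_zero, Real.sqrt_zero] at h0
  refine tendsto_iff_norm_sub_tendsto_zero.2 (h0.congr fun x => ?_)
  rw [← hnorm, Real.sqrt_sq (norm_nonneg _)]

/-- Split `D_x v(x) = D_x (v(x) - v(x₀)) + D_x v(x₀)`; the uniform bound `‖D_x‖ ≤ √b` handles the
first term. This makes strong continuity survive products of operators. -/
theorem Continuous.diagOp_apply {v : (ℤ → Set.Icc (0 : ℝ) b) → EllTwo} (hv : Continuous v) :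
    Continuous fun x => diagOp x (v x) := by
  rw [continuous_iff_continuousAt]
  intro x₀
  have h1 : Tendsto (fun x => diagOp x (v x - v x₀)) (𝓝 x₀) (𝓝 0) := by
    have h2 : Tendsto (fun x => Real.sqrt b * ‖v x - v x₀‖) (𝓝 x₀) (𝓝 0) := by
      have : Continuous fun x => Real.sqrt b * ‖v x - v x₀‖ := by fun_prop
      simpa using this.tendsto x₀
    refine squeeze_zero_norm (fun x => ?_) h2
    exact ((diagOp x).le_opNorm _).trans
      (mul_le_mul_of_nonneg_right (norm_diagOp_le x) (norm_nonneg _))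
  have h2 := h1.add ((continuous_diagOp_apply (b := b) (v x₀)).tendsto x₀)
  rw [zero_add] at h2
  refine h2.congr fun x => ?_
  rw [← map_add, sub_add_cancel]

variable (T : H →L[ℂ] EllTwo)

theorem continuous_gramOp_pow_apply (p : ℕ) (c : EllTwo) :
    Continuous fun x : ℤ → Set.Icc (0 : ℝ) b => (gramOp x T ^ p) c := by
  induction p with
  | zero => simpa using continuous_const
  | succ p ih =>
    simp only [pow_succ', mul_apply_eq_comp, gramOp_apply]
    exact Continuous.diagOp_apply
      (T.continuous.comp ((adjoint T).continuous.comp (Continuous.diagOp_apply ih)))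

theorem spectrum_gramOp_subset (hb : 0 ≤ b) (x : ℤ → Set.Icc (0 : ℝ) b) :
    spectrum ℝ (gramOp x T) ⊆ Set.Icc 0 (b * ‖T‖ ^ 2) := by
  intro t ht
  constructor
  · have hpos : (gramOp x T).IsPositive := isPositive_self_comp_adjoint _
    exact spectrum_nonneg_of_nonneg ((nonneg_iff_isPositive _).2 hpos) ht
  · have h1 := spectrum.subset_closedBall_norm_mul (𝕜 := ℝ) (gramOp x T) ht
    rw [mem_closedBall_zero_iff] at h1
    have h2 : ‖(1 : EllTwo →L[ℂ] EllTwo)‖ ≤ 1 := norm_id_le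
    calc t ≤ ‖t‖ := Real.le_norm_self t
      _ ≤ _ := h1
      _ ≤ ‖gramOp x T‖ * 1 := mul_le_mul_of_nonneg_left h2 (norm_nonneg _)
      _ ≤ _ := by rw [mul_one]; exact norm_gramOp_le x T hb

section QuadForm

variable {E : Type*} [NormedAddCommGroup E] [InnerProductSpace ℂ E] [CompleteSpace E]

theorem norm_cfc_sub_aeval_le {A : E →L[ℂ] E} (hA : IsSelfAdjoint A) {s : Set ℝ} {ε : ℝ}
    (hε : 0 ≤ ε) (hK : spectrum ℝ A ⊆ s) {f : ℝ → ℝ} (hf : Continuous f) {q : ℝ[X]}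
    (hq : ∀ t ∈ s, |q.eval t - f t| ≤ ε) : ‖cfc f A - aeval A q‖ ≤ ε := by
  rw [← cfc_polynomial q A hA, ← cfc_sub (a := A) f q.eval]
  refine norm_cfc_le hε fun t ht => ?_
  rw [Real.norm_eq_abs, abs_sub_comm]
  exact hq t (hK ht)

/-- The quadratic form of `f(A)`. -/
def cfcForm (A : E →L[ℂ] E) (f : ℝ → ℝ) (v : E) : ℝ := (inner ℂ v (cfc f A v)).re

omit [CompleteSpace E] in
theorem abs_re_inner_apply_le (B : E →L[ℂ] E) {v : E} (hv : ‖v‖ = 1) :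
    |(inner ℂ v (B v)).re| ≤ ‖B‖ := by
  refine (Complex.abs_re_le_norm _).trans ((norm_inner_le_norm _ _).trans ?_)
  simpa [hv] using B.le_opNorm v

theorem abs_cfcForm_sub_le {A : E →L[ℂ] E} (hA : IsSelfAdjoint A) {K ε : ℝ}
    (hε : 0 ≤ ε) (hK : spectrum ℝ A ⊆ Set.Icc 0 K) {f : ℝ → ℝ} (hf : Continuous f) {q : ℝ[X]}
    (hq : ∀ t ∈ Set.Icc 0 K, |q.eval t - f t| ≤ ε) {v : E} (hv : ‖v‖ = 1) :
    |cfcForm A f v - cfcForm A q.eval v| ≤ ε := by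
  refine le_trans ?_ ((abs_re_inner_apply_le (cfc f A - aeval A q) hv).trans
    (norm_cfc_sub_aeval_le hA hε hK hf hq))
  rw [cfcForm, cfcForm, cfc_polynomial q A hA, sub_apply, inner_sub_right, Complex.sub_re]

theorem cfcForm_polynomial {A : E →L[ℂ] E} (hA : IsSelfAdjoint A) (q : ℝ[X]) (v : E) :
    cfcForm A q.eval v = ∑ i ∈ Finset.range (q.natDegree + 1),
      q.coeff i * (inner ℂ v ((A ^ i) v)).re := by
  rw [cfcForm, cfc_polynomial q A hA, aeval_eq_sum_range]
  simp only [sum_apply, smul_apply, inner_sum, Complex.re_sum]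
  refine Finset.sum_congr rfl fun i _ => ?_
  rw [← Complex.coe_smul, inner_smul_right, Complex.re_ofReal_mul]

theorem cfcForm_pow {A : E →L[ℂ] E} (hA : IsSelfAdjoint A) (p : ℕ) (v : E) :
    cfcForm A (fun t => t ^ p) v = (inner ℂ v ((A ^ p) v)).re := by
  rw [cfcForm, cfc_pow_id (R := ℝ) A p hA]

end QuadForm

/-- The `n`-th diagonal matrix element of `f(A)`. -/
def diagElem (A : EllTwo →L[ℂ] EllTwo) (f : ℝ → ℝ) (n : ℤ) : ℝ := cfcForm A f (stdVec n)

/-- One polynomial serves every operator with spectrum in `[0, K]` and every site at once.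
Statements about `f(A)` thereby reduce to statements about powers. -/
theorem exists_polynomial_approx (K : ℝ) {f : ℝ → ℝ} (hf : Continuous f) {ε : ℝ} (hε : 0 < ε) :
    ∃ q : ℝ[X], (∀ t ∈ Set.Icc 0 K, |q.eval t - f t| ≤ ε) ∧
      ∀ A : EllTwo →L[ℂ] EllTwo, IsSelfAdjoint A → spectrum ℝ A ⊆ Set.Icc 0 K →
      ∀ n, |diagElem A f n - diagElem A q.eval n| ≤ ε := by
  obtain ⟨q, hq⟩ := exists_polynomial_near_of_continuousOn 0 K f hf.continuousOn ε hε
  exact ⟨q, fun t ht => (hq t ht).le, fun A hA hK n =>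
    abs_cfcForm_sub_le hA hε.le hK hf (fun t ht => (hq t ht).le) (norm_stdVec n)⟩

theorem diagElem_polynomial {A : EllTwo →L[ℂ] EllTwo} (hA : IsSelfAdjoint A) (q : ℝ[X]) (n : ℤ) :
    diagElem A q.eval n = ∑ i ∈ Finset.range (q.natDegree + 1),
      q.coeff i * (inner ℂ (stdVec n) ((A ^ i) (stdVec n))).re :=
  cfcForm_polynomial hA q _

theorem diagElem_pow {A : EllTwo →L[ℂ] EllTwo} (hA : IsSelfAdjoint A) (p : ℕ) (n : ℤ) :
    diagElem A (fun t => t ^ p) n = (inner ℂ (stdVec n) ((A ^ p) (stdVec n))).re :=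
  cfcForm_pow hA p _

theorem continuous_diagElem (hb : 0 ≤ b) {f : ℝ → ℝ} (hf : Continuous f) (n : ℤ) :
    Continuous fun x : ℤ → Set.Icc (0 : ℝ) b => diagElem (gramOp x T) f n := by
  refine continuous_of_uniform_approx_of_continuous fun u hu => ?_
  obtain ⟨ε, hε, h⟩ := Metric.mem_uniformity_dist.1 hu
  obtain ⟨q, -, hq⟩ := exists_polynomial_approx (b * ‖T‖ ^ 2) hf (half_pos hε)
  refine ⟨fun x => diagElem (gramOp x T) q.eval n, ?_, fun x => h ?_⟩
  · simp only [diagElem_polynomial (isSelfAdjoint_gramOp _ T)]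
    have := fun i => continuous_gramOp_pow_apply (b := b) T i (stdVec n)
    fun_prop
  · rw [Real.dist_eq]
    exact (hq _ (isSelfAdjoint_gramOp x T) (spectrum_gramOp_subset T hb x) n).trans_lt
      (half_lt_self hε)

/-- Translation of a sequence. -/
def shiftSeq {α : Type*} (n : ℤ) (x : ℤ → α) : ℤ → α := fun m => x (m + n)

theorem gramOp_stdVec_apply {ψ : ℤ → H} {T : H →L[ℂ] EllTwo} (hT : IsAnalysis ψ T)
    (x : ℤ → Set.Icc (0 : ℝ) b) (m k : ℤ) :
    gramOp x T (stdVec m) k = Real.sqrt (x k) * (Real.sqrt (x m) * inner ℂ (ψ k) (ψ m)) := by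
  rw [gramOp_apply, diagOp_stdVec, map_smul, map_smul, map_smul, hT.adjoint_stdVec,
    lp.coeFn_smul, Pi.smul_apply, diagOp_apply, hT, smul_eq_mul]
  ring

variable {T}

theorem gramOp_pow_shiftSeq {ψ : ℤ → H} (hT : IsAnalysis ψ T)
    (hshift : ∀ n m : ℤ, inner ℂ (ψ (n + 1)) (ψ (m + 1)) = inner ℂ (ψ n) (ψ m))
    (x : ℤ → Set.Icc (0 : ℝ) b) (n l : ℤ) (p : ℕ) (m : ℤ) :
    (gramOp x T ^ p) (stdVec (l + n)) (m + n) =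
      (gramOp (shiftSeq n x) T ^ p) (stdVec l) m := by
  -- Self-adjointness writes a coordinate of `gramOp y T c` as a sum over matrix elements, so the
  -- induction compares numbers and reindexes the sum.
  have key : ∀ y : ℤ → Set.Icc (0 : ℝ) b, ∀ c : EllTwo, ∀ m, gramOp y T c m =
      ∑' k, inner ℂ (gramOp y T (stdVec m) k) (c k) := fun y c m => by
    rw [← lp.inner_eq_tsum, ← inner_stdVec_left, ← adjoint_inner_right,
      (isSelfAdjoint_gramOp y T).adjoint_eq]
  induction p generalizing m with
  | zero =>
    change stdVec (l + n) (m + n) = stdVec l m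
    rcases eq_or_ne m l with rfl | h
    · simp
    · rw [lp.single_apply_ne _ _ _ h, lp.single_apply_ne _ _ _ (by omega)]
  | succ p ih =>
    rw [pow_succ', pow_succ', mul_apply_eq_comp, mul_apply_eq_comp, key, key,
      ← (Equiv.addRight n).tsum_eq]
    refine tsum_congr fun k => ?_
    rw [Equiv.coe_addRight, ih, gramOp_stdVec_apply hT, gramOp_stdVec_apply hT,
      inner_shift hshift]
    rfl

theorem diagElem_shiftSeq {ψ : ℤ → H} (hT : IsAnalysis ψ T)
    (hshift : ∀ n m : ℤ, inner ℂ (ψ (n + 1)) (ψ (m + 1)) = inner ℂ (ψ n) (ψ m))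
    (hb : 0 ≤ b) {f : ℝ → ℝ} (hf : Continuous f) (x : ℤ → Set.Icc (0 : ℝ) b) (n : ℤ) :
    diagElem (gramOp x T) f n = diagElem (gramOp (shiftSeq n x) T) f 0 := by
  refine eq_of_forall_dist_le fun ε hε => ?_
  obtain ⟨q, -, hq⟩ := exists_polynomial_approx (b * ‖T‖ ^ 2) hf (half_pos hε)
  have h1 := hq _ (isSelfAdjoint_gramOp x T) (spectrum_gramOp_subset T hb x) n
  have h2 := hq _ (isSelfAdjoint_gramOp (shiftSeq n x) T)
    (spectrum_gramOp_subset T hb _) 0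
  have h3 : diagElem (gramOp x T) q.eval n = diagElem (gramOp (shiftSeq n x) T) q.eval 0 := by
    rw [diagElem_polynomial (isSelfAdjoint_gramOp _ T),
      diagElem_polynomial (isSelfAdjoint_gramOp _ T)]
    refine Finset.sum_congr rfl fun i _ => ?_
    have := gramOp_pow_shiftSeq hT hshift x n 0 i 0
    rw [zero_add] at this
    rw [inner_stdVec_left, inner_stdVec_left, this]
  rw [Real.dist_eq]
  rw [h3] at h1
  rw [abs_le] at *
  constructor <;> linarith [h1.1, h1.2, h2.1, h2.2]

end

/-! ### The density of states measure and its first two moments -/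

section

open ContinuousLinearMap Polynomial
open scoped CompactlySupported

section QuadForm

variable {E : Type*} [NormedAddCommGroup E] [InnerProductSpace ℂ E] [CompleteSpace E]

theorem cfcForm_add (A : E →L[ℂ] E) {f g : ℝ → ℝ} (hf : Continuous f) (hg : Continuous g) (v : E) :
    cfcForm A (fun t => f t + g t) v = cfcForm A f v + cfcForm A g v := by
  rw [cfcForm, cfc_add (a := A) f g, add_apply, inner_add_right, Complex.add_re, cfcForm, cfcForm]

theorem cfcForm_const_mul (A : E →L[ℂ] E) (c : ℝ) {f : ℝ → ℝ} (hf : Continuous f) (v : E) :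
    cfcForm A (fun t => c * f t) v = c * cfcForm A f v := by
  rw [cfcForm, cfc_const_mul c f, smul_apply, ← Complex.coe_smul, inner_smul_right,
    Complex.re_ofReal_mul, cfcForm]

theorem cfcForm_nonneg {A : E →L[ℂ] E} {f : ℝ → ℝ} (h : ∀ t ∈ spectrum ℝ A, 0 ≤ f t) (v : E) :
    0 ≤ cfcForm A f v := by
  have h1 : 0 ≤ cfc f A := cfc_nonneg h
  exact ((nonneg_iff_isPositive _).1 h1).re_inner_nonneg_right v

theorem cfcForm_congr {A : E →L[ℂ] E} {f g : ℝ → ℝ} (h : Set.EqOn f g (spectrum ℝ A)) (v : E) :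
    cfcForm A f v = cfcForm A g v := by
  rw [cfcForm, cfc_congr h, cfcForm]

theorem cfcForm_one {A : E →L[ℂ] E} (hA : IsSelfAdjoint A) {v : E} (hv : ‖v‖ = 1) :
    cfcForm A (fun _ => 1) v = 1 := by
  rw [cfcForm, cfc_const_one ℝ A]
  simp [hv]

end QuadForm

/-- The average of the spectral measures of a continuous compact family of operators. -/
theorem exists_average_spectralMeasure {X E : Type*} [TopologicalSpace X] [CompactSpace X]
    [MeasurableSpace X] [BorelSpace X] (Q : Measure X) [IsProbabilityMeasure Q]
    [NormedAddCommGroup E] [InnerProductSpace ℂ E] [CompleteSpace E]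
    (A : X → E →L[ℂ] E) (hA : ∀ x, IsSelfAdjoint (A x)) {K : ℝ} (hK : 0 ≤ K)
    (hAK : ∀ x, spectrum ℝ (A x) ⊆ Set.Icc 0 K) {v : E} (hv : ‖v‖ = 1)
    (hcont : ∀ f : ℝ → ℝ, Continuous f → Continuous fun x => cfcForm (A x) f v) :
    ∃ ν : Measure ℝ, IsProbabilityMeasure ν ∧ ν (Set.Icc 0 K)ᶜ = 0 ∧
      ∀ f : ℝ → ℝ, Continuous f → ∫ t, f t ∂ν = ∫ x, cfcForm (A x) f v ∂Q := by
  have hint : ∀ f : ℝ → ℝ, Continuous f → Integrable (fun x => cfcForm (A x) f v) Q := fun f hf =>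
    (hcont f hf).integrable_of_hasCompactSupport (HasCompactSupport.of_compactSpace _)
  -- The Riesz theorem is applied on the compact interval `[0, K]`. How functions are extended
  -- beyond it is immaterial, as every spectrum lies inside.
  let ext : C_c(Set.Icc (0 : ℝ) K, ℝ) → ℝ → ℝ := fun f => Set.IccExtend hK f
  have hext : ∀ f, Continuous (ext f) := fun f => f.continuous.Icc_extend'
  let Λ : C_c(Set.Icc (0 : ℝ) K, ℝ) →ₚ[ℝ] ℝ := PositiveLinearMap.mk₀
    { toFun := fun f => ∫ x, cfcForm (A x) (ext f) v ∂Q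
      map_add' := fun f g => by
        rw [← integral_add (hint _ (hext f)) (hint _ (hext g))]
        refine integral_congr_ae (.of_forall fun x => ?_)
        exact cfcForm_add (A x) (hext f) (hext g) v
      map_smul' := fun c f => by
        rw [RingHom.id_apply, smul_eq_mul, ← integral_const_mul]
        refine integral_congr_ae (.of_forall fun x => ?_)
        exact cfcForm_const_mul (A x) c (hext f) v }
    (fun f hf => integral_nonneg fun x => cfcForm_nonneg (fun t _ => hf _) v)
  let ρ := RealRMK.rieszMeasure Λ
  have hρ : ∀ f : ℝ → ℝ, Continuous f →
      ∫ t : Set.Icc (0 : ℝ) K, f t ∂ρ = ∫ x, cfcForm (A x) f v ∂Q := fun f hf => by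
    have := RealRMK.integral_rieszMeasure Λ
      (CompactlySupportedContinuousMap.continuousMapEquiv ⟨fun t => f t, by fun_prop⟩)
    refine this.trans (integral_congr_ae (.of_forall fun x => ?_))
    refine cfcForm_congr (fun t ht => ?_) v
    exact Set.IccExtend_of_mem hK _ (hAK x ht)
  have hm : MeasurableEmbedding (Subtype.val : Set.Icc (0 : ℝ) K → ℝ) :=
    MeasurableEmbedding.subtype_coe measurableSet_Icc
  have hprob : IsProbabilityMeasure ρ := by
    have h1 := hρ (fun _ => 1) continuous_const
    simp only [cfcForm_one (hA _) hv] at h1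
    rw [integral_const, integral_const, smul_eq_mul, smul_eq_mul, mul_one, mul_one,
      probReal_univ (μ := Q)] at h1
    exact ⟨(ENNReal.toReal_eq_one_iff _).1 h1⟩
  refine ⟨ρ.map Subtype.val, Measure.isProbabilityMeasure_map hm.measurable.aemeasurable, ?_,
    fun f hf => ?_⟩
  · rw [Measure.map_apply hm.measurable measurableSet_Icc.compl]
    convert measure_empty (μ := ρ)
    ext t
    simp
  · rw [hm.integral_map, hρ f hf]

section Moments

variable {H : Type*} [NormedAddCommGroup H] [InnerProductSpace ℂ H] [CompleteSpace H]
variable {b : ℝ} {ψ : ℤ → H} {T : H →L[ℂ] EllTwo}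

theorem diagElem_gramOp_id (hT : IsAnalysis ψ T) (hnorm : ∀ n, ‖ψ n‖ = 1)
    (x : ℤ → Set.Icc (0 : ℝ) b) : diagElem (gramOp x T) (fun t => t) 0 = x 0 := by
  have h := diagElem_pow (isSelfAdjoint_gramOp x T) 1 0
  simp only [pow_one] at h
  rw [h, inner_stdVec_left, gramOp_stdVec_apply hT, inner_self_eq_norm_sq_to_K, hnorm]
  rw [← mul_assoc, ← Complex.ofReal_mul, Real.mul_self_sqrt (x 0).2.1]
  simp

/-- By self-adjointness the corner element of the square is `‖A e_0‖²`, here expanded over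
coordinates. -/
theorem hasSum_diagElem_gramOp_sq (hT : IsAnalysis ψ T) (x : ℤ → Set.Icc (0 : ℝ) b) :
    HasSum (fun k => (x k : ℝ) * x 0 * ‖symbolCoeff ψ k‖ ^ 2)
      (diagElem (gramOp x T) (fun t => t ^ 2) 0) := by
  rw [diagElem_pow (isSelfAdjoint_gramOp x T) 2 0, sq, mul_apply_eq_comp, ← adjoint_inner_left,
    (isSelfAdjoint_gramOp x T).adjoint_eq]
  have h := Complex.hasSum_re (lp.hasSum_inner (𝕜 := ℂ) (gramOp x T (stdVec 0))
    (gramOp x T (stdVec 0)))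
  convert h using 2 with k
  refine Eq.trans ?_ (inner_self_eq_norm_sq (𝕜 := ℂ) (gramOp x T (stdVec 0) k)).symm
  rw [gramOp_stdVec_apply hT, norm_mul, norm_mul, Complex.norm_real,
    Complex.norm_real, norm_inner_symm, symbolCoeff, Real.norm_of_nonneg (Real.sqrt_nonneg _),
    Real.norm_of_nonneg (Real.sqrt_nonneg _)]
  rw [mul_pow, mul_pow, Real.sq_sqrt (x k).2.1,
    Real.sq_sqrt (x 0).2.1, mul_assoc]

omit [CompleteSpace H] in
theorem summable_symbolCoeff (hT : IsAnalysis ψ T) :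
    Summable fun m : ℤ => ‖symbolCoeff ψ m‖ ^ 2 := by
  have := (lp.memℓp (T (ψ 0))).summable (by norm_num)
  refine this.congr fun m => ?_
  rw [hT, symbolCoeff, norm_inner_symm, ENNReal.toReal_ofNat, Real.rpow_ofNat]

theorem integral_diagElem_gramOp_sq (hT : IsAnalysis ψ T) (hnorm : ∀ n, ‖ψ n‖ = 1)
    (μ : Measure (Set.Icc (0 : ℝ) b)) [IsProbabilityMeasure μ] :
    ∫ x, diagElem (gramOp x T) (fun t => t ^ 2) 0 ∂(Measure.infinitePi fun _ : ℤ => μ) =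
      variance (fun t : Set.Icc (0 : ℝ) b => (t : ℝ)) μ +
        (∫ t, (t : ℝ) ∂μ) ^ 2 * ∑' m : ℤ, ‖symbolCoeff ψ m‖ ^ 2 := by
  set Q := Measure.infinitePi fun _ : ℤ => μ with hQ
  have hb : 0 ≤ b := by
    obtain ⟨t⟩ : Nonempty (Set.Icc (0 : ℝ) b) := μ.nonempty_of_neZero
    exact t.2.1.trans t.2.2
  have hsum := summable_symbolCoeff hT
  have h0 : ‖symbolCoeff ψ 0‖ = 1 := by
    rw [symbolCoeff, inner_self_eq_norm_sq_to_K, hnorm]; simp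
  have hmp : ∀ k : ℤ, MeasurePreserving (fun x : ℤ → Set.Icc (0 : ℝ) b => x k) Q μ := fun k =>
    measurePreserving_eval_infinitePi (fun _ => μ) k
  have hI : ∀ {g : Set.Icc (0 : ℝ) b → ℝ}, Continuous g → ∀ k : ℤ,
      ∫ x, g (x k) ∂Q = ∫ t, g t ∂μ := fun {g} hg k => by
    rw [← (hmp k).map_eq, integral_map (hmp k).measurable.aemeasurable
      hg.aestronglyMeasurable]
  -- Independence factorises every term except `k = 0`, where the second moment appears; the excess
  -- of that term over the others is the variance, because `‖symbolCoeff ψ 0‖ = 1`.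
  have hterm : ∀ k : ℤ, ∫ x : ℤ → Set.Icc (0 : ℝ) b, (x k : ℝ) * x 0 ∂Q =
      if k = 0 then ∫ t, (t : ℝ) ^ 2 ∂μ else (∫ t, (t : ℝ) ∂μ) ^ 2 := fun k => by
    split_ifs with hk
    · subst hk
      rw [← hI (g := fun t => (t : ℝ) ^ 2) (by fun_prop) 0]
      simp only [sq]
    · have hind : IndepFun (fun x : ℤ → Set.Icc (0 : ℝ) b => (x k : ℝ))
          (fun x : ℤ → Set.Icc (0 : ℝ) b => (x 0 : ℝ)) Q := by
        have := iIndepFun_infinitePi (P := fun _ : ℤ => μ)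
          (X := fun _ (t : Set.Icc (0 : ℝ) b) => (t : ℝ)) (fun _ => measurable_subtype_coe)
        exact this.indepFun hk
      rw [hind.integral_fun_mul_eq_mul_integral
          (by fun_prop : Measurable fun x : ℤ → Set.Icc (0 : ℝ) b =>
            (x k : ℝ)).aestronglyMeasurable
          (by fun_prop : Measurable fun x : ℤ → Set.Icc (0 : ℝ) b =>
            (x 0 : ℝ)).aestronglyMeasurable,
        hI (g := fun t => (t : ℝ)) (by fun_prop), hI (g := fun t => (t : ℝ)) (by fun_prop), sq]
  have hlim := hasSum_integral_of_dominated_convergence (μ := Q)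
    (F := fun k (x : ℤ → Set.Icc (0 : ℝ) b) => (x k : ℝ) * x 0 * ‖symbolCoeff ψ k‖ ^ 2)
    (f := fun x => diagElem (gramOp x T) (fun t => t ^ 2) 0)
    (fun k _ => b * b * ‖symbolCoeff ψ k‖ ^ 2)
    (fun k => (by fun_prop : Measurable fun x : ℤ → Set.Icc (0 : ℝ) b =>
      (x k : ℝ) * x 0 * ‖symbolCoeff ψ k‖ ^ 2).aestronglyMeasurable)
    (fun k => .of_forall fun x => by
      rw [Real.norm_of_nonneg (mul_nonneg (mul_nonneg (x k).2.1 (x 0).2.1) (by positivity))]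
      exact mul_le_mul_of_nonneg_right
        (mul_le_mul (x k).2.2 (x 0).2.2 (x 0).2.1 hb) (by positivity))
    (.of_forall fun _ => hsum.mul_left _) (integrable_const _)
    (.of_forall fun x => hasSum_diagElem_gramOp_sq hT x)
  simp only [integral_mul_const, hterm] at hlim
  have hvar : variance (fun t : Set.Icc (0 : ℝ) b => (t : ℝ)) μ =
      ∫ t, (t : ℝ) ^ 2 ∂μ - (∫ t, (t : ℝ) ∂μ) ^ 2 := by
    refine variance_eq_sub ?_
    exact MemLp.of_bound (by fun_prop) b (.of_forall fun t => by
      rw [Real.norm_of_nonneg t.2.1]; exact t.2.2)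
  have h2 := (hsum.hasSum.mul_left ((∫ t, (t : ℝ) ∂μ) ^ 2)).add
    (hasSum_ite_eq (0 : ℤ) (variance (fun t : Set.Icc (0 : ℝ) b => (t : ℝ)) μ))
  rw [add_comm]
  refine hlim.unique (h2.congr_fun fun k => ?_)
  split_ifs with hk
  · subst hk
    rw [h0, hvar]; ring
  · ring

end Moments

end

/-! ### Averages and the ergodic theorem on a Bernoulli scheme -/

section

section Averages

theorem sum_range_mul_eq (a : ℕ → ℝ) (q L : ℕ) :
    ∑ n ∈ Finset.range (q * L), a n =
      ∑ r ∈ Finset.range q, ∑ k ∈ Finset.range L, a (r + q * k) := by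
  induction L with
  | zero => simp
  | succ L ih =>
    rw [mul_add, mul_one, Finset.sum_range_add, ih, ← Finset.sum_add_distrib]
    refine Finset.sum_congr rfl fun r _ => ?_
    rw [Finset.sum_range_succ, add_comm (q * L)]

/-- Averages converge if they converge along all residue classes. -/
theorem tendsto_average_of_residues {a : ℕ → ℝ} {B c : ℝ} (hB : ∀ n, |a n| ≤ B) {q : ℕ}
    (hq : 0 < q) (h : ∀ r < q, Tendsto
      (fun L : ℕ => (∑ k ∈ Finset.range L, a (r + q * k)) / L) atTop (𝓝 c)) :
    Tendsto (fun N : ℕ => (∑ n ∈ Finset.range N, a n) / N) atTop (𝓝 c) := by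
  have hB0 : 0 ≤ B := (abs_nonneg _).trans (hB 0)
  have h1 : Tendsto (fun L : ℕ => (∑ n ∈ Finset.range (q * L), a n) / L) atTop (𝓝 (q * c)) := by
    have := tendsto_finsetSum (Finset.range q) fun r hr => h r (Finset.mem_range.1 hr)
    simp only [Finset.sum_const, Finset.card_range, nsmul_eq_mul] at this
    refine this.congr fun L => ?_
    rw [sum_range_mul_eq, Finset.sum_div]
  have h2 : Tendsto (fun N : ℕ => N / q) atTop atTop :=
    Nat.tendsto_div_const_atTop hq.ne'
  have h3 := (tendsto_iff_norm_sub_tendsto_zero.1 (h1.comp h2))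
  -- The first `N` terms consist of `N / q` complete blocks and at most `q` further terms; the
  -- latter, together with the normalisation error, cost at most `q (B + |c|) / N`.
  have h4 : Tendsto (fun N : ℕ => (q * (B + |c|) : ℝ) / N) atTop (𝓝 0) :=
    tendsto_const_div_atTop_nhds_zero_nat _
  have h5 := h3.add h4
  rw [add_zero] at h5
  refine tendsto_iff_norm_sub_tendsto_zero.2 (squeeze_zero' (.of_forall fun _ => norm_nonneg _)
    ?_ h5)
  filter_upwards [eventually_ge_atTop q] with N hN
  have hL : 0 < N / q := Nat.div_pos hN hq
  have hN0 : 0 < N := hq.trans_le hN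
  set L := N / q with hLdef
  have hdec : N = q * L + N % q := (Nat.div_add_mod N q).symm
  have hL0 : (0 : ℝ) < L := by exact_mod_cast hL
  have hNr : (0 : ℝ) < N := by exact_mod_cast hN0
  have hLN : (L : ℝ) ≤ N := by exact_mod_cast Nat.div_le_self N q
  have hmod : ((N % q : ℕ) : ℝ) ≤ q := by exact_mod_cast (Nat.mod_lt N hq).le
  have hNr2 : (N : ℝ) = q * L + (N % q : ℕ) := by exact_mod_cast hdec
  have hS : ∑ n ∈ Finset.range N, a n = ∑ n ∈ Finset.range (q * L), a n +
      ∑ i ∈ Finset.range (N % q), a (q * L + i) := by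
    conv_lhs => rw [hdec]
    rw [Finset.sum_range_add]
  set S := ∑ n ∈ Finset.range (q * L), a n
  set R := ∑ i ∈ Finset.range (N % q), a (q * L + i) with hR
  have hRb : |R| ≤ q * B := by
    refine (Finset.abs_sum_le_sum_abs _ _).trans ((Finset.sum_le_sum fun i _ => hB _).trans ?_)
    rw [Finset.sum_const, Finset.card_range, nsmul_eq_mul]
    exact mul_le_mul_of_nonneg_right hmod hB0
  have heq : (∑ n ∈ Finset.range N, a n) / N - c =
      (S / L - q * c) * (L / N) + (R - (N % q : ℕ) * c) / N := by
    rw [hS]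
    have : c = (q * L + (N % q : ℕ)) * c / N := by rw [← hNr2]; field_simp
    conv_lhs => rw [this]
    field_simp
    ring
  rw [heq]
  refine (norm_add_le _ _).trans (add_le_add ?_ ?_)
  · rw [norm_mul, Function.comp_apply]
    refine mul_le_of_le_one_right (norm_nonneg _) ?_
    rw [Real.norm_of_nonneg (by positivity)]
    exact div_le_one_of_le₀ hLN hNr.le
  · rw [norm_div, Real.norm_of_nonneg hNr.le]
    refine div_le_div_of_nonneg_right ?_ hNr.le
    refine (norm_sub_le _ _).trans ?_
    rw [norm_mul, Real.norm_natCast, Real.norm_eq_abs, Real.norm_eq_abs, mul_add]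
    exact add_le_add hRb (mul_le_mul_of_nonneg_right hmod (abs_nonneg _))

/-- The strong law of large numbers for bounded identically distributed variables that are
independent at distance at least `q`. -/
theorem strong_law_of_indep_at_distance {Ω : Type*} [MeasurableSpace Ω] {P : Measure Ω}
    [IsProbabilityMeasure P] {Y : ℕ → Ω → ℝ} {B : ℝ} (hY : Measurable (Y 0))
    (hB : ∀ n ω, |Y n ω| ≤ B) (hident : ∀ n, IdentDistrib (Y n) (Y 0) P P) {q : ℕ} (hq : 0 < q)
    (hind : ∀ i j, i + q ≤ j → IndepFun (Y i) (Y j) P) :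
    ∀ᵐ ω ∂P, Tendsto (fun N : ℕ => (∑ n ∈ Finset.range N, Y n ω) / N) atTop
      (𝓝 (∫ ω, Y 0 ω ∂P)) := by
  have hint : Integrable (Y 0) P := Integrable.of_bound hY.aestronglyMeasurable B
    (.of_forall (hB 0))
  have hr : ∀ r : ℕ, ∀ᵐ ω ∂P, Tendsto
      (fun L : ℕ => (∑ k ∈ Finset.range L, Y (r + q * k) ω) / L) atTop (𝓝 (∫ ω, Y 0 ω ∂P)) := by
    intro r
    -- Within a residue class mod `q` distinct indices differ by at least `q`, so the variables are
    -- pairwise independent, which is all that this strong law requires.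
    have h := strong_law_ae_real (μ := P) (fun k => Y (r + q * k))
      ((hident _).symm.integrable_snd hint) (fun i j hij => ?_)
      fun k => (hident _).trans (hident _).symm
    · rwa [(hident _).integral_eq] at h
    · rcases lt_or_gt_of_ne hij with h | h
      · exact hind _ _ (by nlinarith [Nat.succ_le_of_lt h])
      · exact (hind _ _ (by nlinarith [Nat.succ_le_of_lt h])).symm
  filter_upwards [ae_all_iff.2 hr] with ω hω
  exact tendsto_average_of_residues (fun n => hB n ω) hq fun r _ => hω r

theorem sum_Icc_neg (a : ℤ → ℝ) (N : ℕ) :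
    ∑ n ∈ Finset.Icc (-(N : ℤ)) N, a n = ∑ n ∈ Finset.range (N + 1), a n +
      ∑ n ∈ Finset.range (N + 1), a (-n) - a 0 := by
  induction N with
  | zero => simp
  | succ N ih =>
    have : Finset.Icc (-((N + 1 : ℕ) : ℤ)) ((N + 1 : ℕ) : ℤ) =
        insert (-((N + 1 : ℕ) : ℤ)) (insert ((N + 1 : ℕ) : ℤ) (Finset.Icc (-(N : ℤ)) N)) := by
      ext k; simp only [Finset.mem_Icc, Finset.mem_insert]; omega
    rw [this, Finset.sum_insert (by simp only [Finset.mem_Icc, Finset.mem_insert]; omega),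
      Finset.sum_insert (by simp only [Finset.mem_Icc]; omega), ih,
      Finset.sum_range_succ _ (N + 1), Finset.sum_range_succ _ (N + 1)]
    ring

theorem tendsto_average_Icc_neg {a : ℤ → ℝ} {c : ℝ}
    (h1 : Tendsto (fun N : ℕ => (∑ n ∈ Finset.range N, a n) / N) atTop (𝓝 c))
    (h2 : Tendsto (fun N : ℕ => (∑ n ∈ Finset.range N, a (-n)) / N) atTop (𝓝 c)) :
    Tendsto (fun N : ℕ => (2 * (N : ℝ) + 1)⁻¹ * ∑ n ∈ Finset.Icc (-(N : ℤ)) N, a n) atTop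
      (𝓝 c) := by
  have hinv : Tendsto (fun N : ℕ => (1 : ℝ) / ((N : ℝ) + 1)) atTop (𝓝 0) :=
    tendsto_one_div_add_atTop_nhds_zero_nat
  have h3 := (((h1.comp (tendsto_add_atTop_nat 1)).add (h2.comp (tendsto_add_atTop_nat 1))).sub
    (hinv.const_mul (a 0))).mul
    ((tendsto_const_nhds (x := (2 : ℝ))).sub hinv |>.inv₀ (by norm_num))
  have hc : (c + c - a 0 * 0) * (2 - 0)⁻¹ = c := by ring
  rw [hc] at h3
  refine h3.congr fun N => ?_
  rw [sum_Icc_neg]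
  simp only [Function.comp_apply]
  push_cast
  have : (0 : ℝ) < N + 1 := by positivity
  have h4 : (2 : ℝ) - 1 / (N + 1) = (2 * N + 1) / (N + 1) := by field_simp; ring
  rw [h4]
  field_simp

end Averages

section Ergodic

variable {α : Type*} [MetricSpace α] [CompactSpace α]

/-- A continuous function on a compact product depends essentially on finitely many coordinates. -/
theorem exists_window {F : (ℤ → α) → ℝ} (hF : Continuous F) {ε : ℝ} (hε : 0 < ε) :
    ∃ R : ℕ, ∀ x y : ℤ → α, (∀ m ∈ Finset.Icc (-(R : ℤ)) R, x m = y m) → |F x - F y| ≤ ε := by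
  have hu := CompactSpace.uniformContinuous_of_continuous hF
  -- A basic entourage of the product uniformity constrains only a finite set `I` of coordinates;
  -- `R` is chosen so that `[-R, R]` contains `I`.
  have hmem := hu (Metric.dist_mem_uniformity hε)
  rw [mem_map, Pi.uniformity, mem_iInf] at hmem
  obtain ⟨I, hI, V, hV, hVeq⟩ := hmem
  obtain ⟨R, hR⟩ : ∃ R : ℕ, ∀ i ∈ I, i.natAbs ≤ R := by
    obtain ⟨R, hR⟩ := (hI.image Int.natAbs).bddAbove
    exact ⟨R, fun i hi => hR ⟨i, hi, rfl⟩⟩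
  refine ⟨R, fun x y hxy => ?_⟩
  have : (x, y) ∈ ⋂ i, V i := by
    refine Set.mem_iInter.2 fun i => ?_
    obtain ⟨W, hW, hWV⟩ := hV i
    refine hWV ?_
    have hi := hR i i.2
    have : x i = y i := hxy _ (Finset.mem_Icc.2 (by omega))
    change (x i, y i) ∈ W
    rw [this]
    exact refl_mem_uniformity hW
  rw [← hVeq] at this
  exact (le_of_lt this : dist (F x) (F y) ≤ ε)

variable [MeasurableSpace α] [BorelSpace α]

omit [MetricSpace α] [CompactSpace α] [BorelSpace α] in
theorem measurePreserving_shiftSeq (μ : Measure α) [IsProbabilityMeasure μ] (n : ℤ) :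
    MeasurePreserving (shiftSeq n) (Measure.infinitePi fun _ : ℤ => μ)
      (Measure.infinitePi fun _ : ℤ => μ) := by
  refine ⟨measurable_pi_lambda _ fun m => measurable_pi_apply _, ?_⟩
  exact Measure.map_infinitePi_infinitePi_of_inj (P := fun _ : ℤ => μ)
    (f := fun m : ℤ => m + n) (add_left_injective n)

/-- Replace the coordinates outside `[-R, R]` by a constant. -/
def freeze {α : Type*} (c : α) (R : ℕ) (x : ℤ → α) : ℤ → α :=
  fun m => if m ∈ Finset.Icc (-(R : ℤ)) R then x m else c

omit [CompactSpace α] [MeasurableSpace α] [BorelSpace α] in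
theorem continuous_freeze (c : α) (R : ℕ) : Continuous (freeze c R) := by
  refine continuous_pi fun m => ?_
  unfold freeze
  split_ifs <;> fun_prop

/-- The two functions read only the coordinates in `[i - R, i + R]` and `[j - R, j + R]`, which are
disjoint when `|i - j| > 2R`. -/
theorem indepFun_freeze_shiftSeq (μ : Measure α) [IsProbabilityMeasure μ] {F : (ℤ → α) → ℝ}
    (hF : Continuous F) (c : α) (R : ℕ) {i j : ℤ} (hij : 2 * (R : ℤ) < |i - j|) :
    IndepFun (fun x => F (freeze c R (shiftSeq i x))) (fun x => F (freeze c R (shiftSeq j x)))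
      (Measure.infinitePi fun _ : ℤ => μ) := by
  have hcoord : iIndepFun (fun (n : ℤ) (x : ℤ → α) => x n) (Measure.infinitePi fun _ : ℤ => μ) :=
    iIndepFun_infinitePi (X := fun _ t => t) fun _ => measurable_id
  let W : ℤ → Finset ℤ := fun k => Finset.Icc (k - R) (k + R)
  have hmem : ∀ {k m : ℤ}, m ∈ Finset.Icc (-(R : ℤ)) R → m + k ∈ W k := by
    intro k m hm
    simp only [W, Finset.mem_Icc] at *
    omega
  let g : ∀ k : ℤ, (W k → α) → ℝ := fun k z =>
    F fun m => if h : m ∈ Finset.Icc (-(R : ℤ)) R then z ⟨m + k, hmem h⟩ else c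
  have hg : ∀ k, Measurable (g k) := fun k => by
    refine Continuous.measurable (hF.comp (continuous_pi fun m => ?_))
    split_ifs <;> fun_prop
  have hdisj : Disjoint (W i) (W j) := by
    rw [Finset.disjoint_left]
    intro m h1 h2
    simp only [W, Finset.mem_Icc] at h1 h2
    rcases abs_cases (i - j) with h | h <;> omega
  have h := (hcoord.indepFun_finset (W i) (W j) hdisj fun n => measurable_pi_apply n).comp
    (hg i) (hg j)
  have hgk : ∀ k, (fun x : ℤ → α => F (freeze c R (shiftSeq k x))) =
      g k ∘ fun x (n : W k) => x n := fun k => by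
    funext x
    simp only [g, Function.comp_apply]
    congr 1
  rw [hgk, hgk]
  exact h

/-- The strong law is applied to the versions of `F` frozen outside `[-R, R]`, which converge to `F`
uniformly. The step `s` is later taken to be `1` and `-1` to cover both half-lines. -/
theorem ae_tendsto_average_range (μ : Measure α) [IsProbabilityMeasure μ] {F : (ℤ → α) → ℝ}
    (hF : Continuous F) {s : ℤ} (hs : s ≠ 0) :
    ∀ᵐ x ∂(Measure.infinitePi fun _ : ℤ => μ), Tendsto
      (fun N : ℕ => (∑ n ∈ Finset.range N, F (shiftSeq (s * n) x)) / N) atTop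
      (𝓝 (∫ x, F x ∂(Measure.infinitePi fun _ : ℤ => μ))) := by
  set Q := Measure.infinitePi fun _ : ℤ => μ
  obtain ⟨c⟩ : Nonempty α := μ.nonempty_of_neZero
  obtain ⟨B, hB⟩ : ∃ B, ∀ x, |F x| ≤ B := by
    obtain ⟨B, hB⟩ := isCompact_univ.exists_bound_of_continuousOn hF.continuousOn
    exact ⟨B, fun x => hB x trivial⟩
  have hbdd : ∀ {F' : (ℤ → α) → ℝ}, Continuous F' → Integrable F' Q := fun h =>
    h.integrable_of_hasCompactSupport (HasCompactSupport.of_compactSpace _)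
  have hloc : ∀ R : ℕ, ∀ᵐ x ∂Q, Tendsto
      (fun N : ℕ => (∑ n ∈ Finset.range N, F (freeze c R (shiftSeq (s * n) x))) / N) atTop
      (𝓝 (∫ x, F (freeze c R x) ∂Q)) := by
    intro R
    have hFR : Continuous fun x => F (freeze c R x) := hF.comp (continuous_freeze c R)
    have hY : ∀ n : ℤ, Measurable fun x => F (freeze c R (shiftSeq n x)) := fun n =>
      hFR.measurable.comp (measurePreserving_shiftSeq μ n).measurable
    have hid : ∀ n : ℤ, IdentDistrib (fun x => F (freeze c R (shiftSeq n x)))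
        (fun x => F (freeze c R x)) Q Q := fun n => by
      refine ⟨(hY n).aemeasurable, hFR.measurable.aemeasurable, ?_⟩
      have hmp : MeasurePreserving (shiftSeq n) Q Q := measurePreserving_shiftSeq μ n
      exact (Measure.map_map hFR.measurable hmp.measurable).symm.trans (by rw [hmp.map_eq])
    have h := strong_law_of_indep_at_distance (P := Q)
      (Y := fun n x => F (freeze c R (shiftSeq (s * n) x))) (B := B) (q := 2 * R + 1)
      (hY _) (fun n x => hB _) (fun n => (hid _).trans (hid _).symm) (by omega) (fun i j hij => by
        refine indepFun_freeze_shiftSeq μ hF c R ?_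
        rw [← mul_sub, abs_mul]
        have h1 : 1 ≤ |s| := Int.one_le_abs hs
        have h2 : 2 * (R : ℤ) + 1 ≤ |(i : ℤ) - j| := by
          rcases abs_cases ((i : ℤ) - j) with h | h <;> omega
        nlinarith)
    have h0 : ∀ x : ℤ → α, shiftSeq 0 x = x := fun x => funext fun m => by simp [shiftSeq]
    simpa [h0] using h
  -- There are countably many `R`, so a single null set suffices, and `R` may then be chosen
  -- depending on `ε`.
  filter_upwards [ae_all_iff.2 hloc] with x hx
  rw [Metric.tendsto_atTop]
  intro ε hε
  obtain ⟨R, hR⟩ := exists_window hF (show 0 < ε / 4 by positivity)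
  have hRF : ∀ y, |F y - F (freeze c R y)| ≤ ε / 4 := fun y => hR _ _ fun m hm => by
    rw [freeze, if_pos hm]
  obtain ⟨N₀, hN₀⟩ := Metric.tendsto_atTop.1 (hx R) (ε / 4) (by positivity)
  refine ⟨N₀, fun N hN => ?_⟩
  have h1 := hN₀ N hN
  have h2 : |(∑ n ∈ Finset.range N, F (shiftSeq (s * n) x)) / N -
      (∑ n ∈ Finset.range N, F (freeze c R (shiftSeq (s * n) x))) / N| ≤ ε / 4 := by
    rw [← sub_div, ← Finset.sum_sub_distrib, abs_div, Nat.abs_cast]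
    refine div_le_of_le_mul₀ (by positivity) (by positivity) ?_
    refine (Finset.abs_sum_le_sum_abs _ _).trans ((Finset.sum_le_sum fun n _ => hRF _).trans ?_)
    simp [mul_comm]
  have h3 : |∫ x, F x ∂Q - ∫ x, F (freeze c R x) ∂Q| ≤ ε / 4 := by
    rw [← integral_sub (hbdd hF) (hbdd (F' := fun x => F (freeze c R x))
      (hF.comp (continuous_freeze c R)))]
    have := norm_integral_le_of_norm_le_const (μ := Q)
      (f := fun x => F x - F (freeze c R x)) (.of_forall hRF)
    simpa using this
  rw [Real.dist_eq] at h1 ⊢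
  rw [abs_lt] at *
  rw [abs_le] at h2 h3
  constructor <;> linarith [h1.1, h1.2, h2.1, h2.2, h3.1, h3.2]

/-- The ergodic theorem for continuous functions on a Bernoulli scheme. -/
theorem ae_tendsto_average (μ : Measure α) [IsProbabilityMeasure μ] {F : (ℤ → α) → ℝ}
    (hF : Continuous F) :
    ∀ᵐ x ∂(Measure.infinitePi fun _ : ℤ => μ), Tendsto
      (fun N : ℕ => (2 * (N : ℝ) + 1)⁻¹ * ∑ n ∈ Finset.Icc (-(N : ℤ)) N, F (shiftSeq n x)) atTop
      (𝓝 (∫ x, F x ∂(Measure.infinitePi fun _ : ℤ => μ))) := by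
  filter_upwards [ae_tendsto_average_range μ hF one_ne_zero,
    ae_tendsto_average_range μ hF (neg_ne_zero.2 one_ne_zero)] with x h1 h2
  refine tendsto_average_Icc_neg ?_ ?_
  · simpa using h1
  · simpa using h2

end Ergodic

end

/-! ### Eigenvalues of the finite sums: traces and counting measures -/

section

open ContinuousLinearMap Polynomial

section FiniteDimensional

variable {E : Type*} [NormedAddCommGroup E] [InnerProductSpace ℂ E] [CompleteSpace E]

omit [CompleteSpace E] in
theorem aeval_apply_of_eigenvector {A : E →L[ℂ] E} {v : E} {t : ℝ} (hv : A v = (t : ℂ) • v)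
    (q : ℝ[X]) : aeval A q v = ((q.eval t : ℝ) : ℂ) • v := by
  have hpow : ∀ i : ℕ, (A ^ i) v = ((t ^ i : ℝ) : ℂ) • v := fun i => by
    induction i with
    | zero => simp
    | succ i ih =>
      rw [pow_succ', mul_apply_eq_comp, ih, map_smul, hv, smul_smul, pow_succ]
      push_cast
      rfl
  rw [aeval_eq_sum_range, eval_eq_sum_range]
  simp only [sum_apply, smul_apply, hpow]
  push_cast
  rw [Finset.sum_smul]
  refine Finset.sum_congr rfl fun i _ => ?_
  rw [← Complex.coe_smul, smul_smul]

theorem cfc_apply_of_eigenvector {A : E →L[ℂ] E} (hA : IsSelfAdjoint A) {v : E} {t : ℝ}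
    (hv : A v = (t : ℂ) • v) {f : ℝ → ℝ} (hf : Continuous f) :
    cfc f A v = (f t : ℂ) • v := by
  -- The interval is made to contain both the spectrum and `t`, so that one polynomial approximates
  -- `f` at both.
  set r := max (‖A‖ * ‖(1 : E →L[ℂ] E)‖) |t| with hr
  have hspec : spectrum ℝ A ⊆ Set.Icc (-r) r := fun s hs => by
    have h1 := spectrum.subset_closedBall_norm_mul (𝕜 := ℝ) A hs
    rw [mem_closedBall_zero_iff, Real.norm_eq_abs] at h1
    exact abs_le.1 (h1.trans (le_max_left _ _))
  have ht : t ∈ Set.Icc (-r) r := abs_le.1 (le_max_right _ _)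
  rw [← sub_eq_zero, ← norm_le_zero_iff]
  refine le_of_forall_pos_le_add fun δ hδ => ?_
  obtain ⟨q, hq⟩ := exists_polynomial_near_of_continuousOn (-r) r f hf.continuousOn
    (δ / (2 * (‖v‖ + 1))) (by positivity)
  have h1 := norm_cfc_sub_aeval_le hA (by positivity) hspec hf fun s hs => (hq s hs).le
  have h2 : cfc f A v - (f t : ℂ) • v =
      (cfc f A - aeval A q) v + ((q.eval t - f t : ℝ) : ℂ) • v := by
    rw [sub_apply, aeval_apply_of_eigenvector hv, Complex.ofReal_sub, sub_smul]
    abel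
  have h3 : ‖(cfc f A - aeval A q) v‖ ≤ δ / (2 * (‖v‖ + 1)) * (‖v‖ + 1) :=
    (le_opNorm _ _).trans (mul_le_mul h1 (by linarith) (norm_nonneg _) (by positivity))
  have h4 : ‖((q.eval t - f t : ℝ) : ℂ) • v‖ ≤ δ / (2 * (‖v‖ + 1)) * (‖v‖ + 1) := by
    rw [norm_smul, Complex.norm_real]
    exact mul_le_mul (hq t ht).le (by linarith) (norm_nonneg _) (by positivity)
  have h5 : δ / (2 * (‖v‖ + 1)) * (‖v‖ + 1) = δ / 2 := by
    have : ‖v‖ + 1 ≠ 0 := by positivity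
    field_simp
  rw [h2, zero_add]
  refine (norm_add_le _ _).trans ?_
  linarith

variable [FiniteDimensional ℂ E]

theorem traceFun_eq_sum_eigenvalues {A : E →L[ℂ] E} (hA : IsSelfAdjoint A)
    {d : ℕ} (hd : Module.finrank ℂ E = d) {f : ℝ → ℝ} (hf : Continuous f) :
    traceFun A f = ((∑ i, f (hA.isSymmetric.eigenvalues hd i) : ℝ) : ℂ) := by
  rw [traceFun, LinearMap.trace_eq_sum_inner _ (hA.isSymmetric.eigenvectorBasis hd)]
  push_cast
  refine Finset.sum_congr rfl fun i _ => ?_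
  have h : cfc f A (hA.isSymmetric.eigenvectorBasis hd i) =
      (f (hA.isSymmetric.eigenvalues hd i) : ℂ) • hA.isSymmetric.eigenvectorBasis hd i :=
    cfc_apply_of_eigenvector hA (hA.isSymmetric.apply_eigenvectorBasis hd i) hf
  change inner ℂ _ (cfc f A (hA.isSymmetric.eigenvectorBasis hd i)) = _
  rw [h, inner_smul_right, inner_self_eq_norm_sq_to_K]
  simp

/-- Triviality of the kernel ensures that no eigenvalue is lost in the sum over `t ≠ 0`. -/
theorem sum_finrank_smul_dirac {A : E →L[ℂ] E} (hA : IsSelfAdjoint A)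
    (hker : ∀ v, A v = 0 → v = 0) {d : ℕ} (hd : Module.finrank ℂ E = d) :
    (Measure.sum fun t : {t : ℝ // t ≠ 0} =>
      (Module.finrank ℂ (Module.End.eigenspace (A : E →ₗ[ℂ] E) ((t : ℝ) : ℂ)) : ℝ≥0∞) •
        Measure.dirac (t : ℝ)) =
      ∑ i, Measure.dirac (hA.isSymmetric.eigenvalues hd i) := by
  set l := hA.isSymmetric.eigenvalues hd with hl
  have hl0 : ∀ i, l i ≠ 0 := fun i hi => by
    have h1 := hA.isSymmetric.apply_eigenvectorBasis hd i
    rw [← hl, hi] at h1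
    have h2 := hker (hA.isSymmetric.eigenvectorBasis hd i)
      (h1.trans (by rw [RCLike.ofReal_zero, zero_smul]))
    have := (hA.isSymmetric.eigenvectorBasis hd).norm_eq_one i
    rw [h2, norm_zero] at this
    exact zero_ne_one this
  ext s hs
  have hterm : ∀ t : {t : ℝ // t ≠ 0}, ((Module.finrank ℂ
      (Module.End.eigenspace (A : E →ₗ[ℂ] E) ((t : ℝ) : ℂ)) : ℝ≥0∞) • Measure.dirac (t : ℝ)) s =
      ∑ i, if l i = t then s.indicator 1 (l i) else 0 := fun t => by
    rw [← hA.isSymmetric.card_filter_eigenvalues_eq hd, Measure.smul_apply,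
      Measure.dirac_apply' _ hs, ← Finset.sum_filter, smul_eq_mul]
    have : ∀ i ∈ Finset.univ.filter (fun i => l i = (t : ℝ)),
        (s.indicator 1 (l i) : ℝ≥0∞) = s.indicator 1 (t : ℝ) := fun i hi => by
      rw [(Finset.mem_filter.1 hi).2]
    rw [Finset.sum_congr rfl this, Finset.sum_const, nsmul_eq_mul]
    congr 3
    ext i
    simp only [Finset.mem_filter, Finset.mem_univ, true_and]
    exact Complex.ofReal_inj
  rw [Measure.sum_apply _ hs, tsum_congr hterm, Summable.tsum_finsetSum fun _ _ => ENNReal.summable,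
    Measure.finsetSum_apply]
  refine Finset.sum_congr rfl fun i _ => ?_
  rw [tsum_eq_single ⟨l i, hl0 i⟩ fun t ht => if_neg fun h => ht (Subtype.ext h.symm), if_pos rfl,
    Measure.dirac_apply' _ hs]

end FiniteDimensional

section FinOp

variable {H : Type*} [NormedAddCommGroup H] [InnerProductSpace ℂ H]

theorem inner_finOp_left (ψ : ℤ → H) (κ : ℤ → ℝ) (N : ℕ) (x y : H) :
    (inner ℂ (finOp ψ κ N x) y : ℂ) = inner ℂ x (finOp ψ κ N y) := by
  simp only [finOp, sum_apply, smul_apply, InnerProductSpace.rankOne_apply, sum_inner, inner_sum,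
    inner_smul_left, inner_smul_right, Complex.conj_ofReal, inner_conj_symm]
  exact Finset.sum_congr rfl fun n _ => by ring

/-- Kernel and range of a symmetric operator are orthogonal. -/
theorem finOpRan_eq_zero (ψ : ℤ → H) (κ : ℤ → ℝ) (N : ℕ) (v : finRan ψ κ N)
    (hv : finOpRan ψ κ N v = 0) : v = 0 := by
  obtain ⟨v, ⟨y, hy⟩⟩ := v
  have h : finOp ψ κ N v = 0 := congrArg Subtype.val hv
  ext
  change v = 0
  rw [← inner_self_eq_zero (𝕜 := ℂ)]
  nth_rewrite 2 [← hy]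
  rw [coe_coe, ← inner_finOp_left, h, inner_zero_left]

/-- An eigenvector for `t ≠ 0` is the image of `t⁻¹` times itself, hence already lies in the range.
-/
theorem finrank_eigenspace_finOpRan (ψ : ℤ → H) (κ : ℤ → ℝ) (N : ℕ) {t : ℂ} (ht : t ≠ 0) :
    Module.finrank ℂ (Module.End.eigenspace (finOpRan ψ κ N : _ →ₗ[ℂ] finRan ψ κ N) t) =
      Module.finrank ℂ (Module.End.eigenspace (finOp ψ κ N : H →ₗ[ℂ] H) t) := by
  have h : Submodule.map (finRan ψ κ N).subtype
      (Module.End.eigenspace (finOpRan ψ κ N : _ →ₗ[ℂ] finRan ψ κ N) t) =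
      Module.End.eigenspace (finOp ψ κ N : H →ₗ[ℂ] H) t := by
    ext v
    rw [Submodule.mem_map]
    constructor
    · rintro ⟨w, hw, rfl⟩
      rw [Module.End.mem_eigenspace_iff] at hw ⊢
      exact congrArg Subtype.val hw
    · intro hv
      rw [Module.End.mem_eigenspace_iff] at hv
      have hmem : v ∈ finRan ψ κ N :=
        LinearMap.mem_range.2 ⟨t⁻¹ • v, by rw [map_smul, hv, inv_smul_smul₀ ht]⟩
      exact ⟨⟨v, hmem⟩, Module.End.mem_eigenspace_iff.2 (Subtype.ext hv), rfl⟩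
  rw [← h, Submodule.finrank_map_subtype_eq]

/-- The eigenvalues of `finOpRan`, with multiplicity. -/
def finEigenvalues (ψ : ℤ → H) (κ : ℤ → ℝ) (N : ℕ) :
    Fin (Module.finrank ℂ (finRan ψ κ N)) → ℝ :=
  (finOpRan_isSelfAdjoint ψ κ N).isSymmetric.eigenvalues rfl

theorem normTrace_eq (ψ : ℤ → H) (κ : ℤ → ℝ) (N : ℕ) {f : ℝ → ℝ} (hf : Continuous f) :
    normTrace ψ κ N f = (((2 * (N : ℝ) + 1)⁻¹ * ∑ i, f (finEigenvalues ψ κ N i) : ℝ) : ℂ) := by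
  rw [normTrace, traceFun_eq_sum_eigenvalues (finOpRan_isSelfAdjoint ψ κ N) rfl hf]
  push_cast
  rfl

theorem integral_countMeasure (ψ : ℤ → H) (κ : ℤ → ℝ) (N : ℕ) (f : ℝ → ℝ) :
    ∫ t, f t ∂(countMeasure ψ κ N) =
      (2 * (N : ℝ) + 1)⁻¹ * ∑ i, f (finEigenvalues ψ κ N i) := by
  have h : (Measure.sum fun t : {t : ℝ // t ≠ 0} =>
      (Module.finrank ℂ (Module.End.eigenspace (finOp ψ κ N : H →ₗ[ℂ] H) ((t : ℝ) : ℂ)) : ℝ≥0∞) •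
        Measure.dirac (t : ℝ)) = ∑ i, Measure.dirac (finEigenvalues ψ κ N i) := by
    refine Eq.trans ?_
      (sum_finrank_smul_dirac (finOpRan_isSelfAdjoint ψ κ N) (finOpRan_eq_zero ψ κ N) rfl)
    congr 1
    funext t
    rw [finrank_eigenspace_finOpRan ψ κ N (Complex.ofReal_ne_zero.2 t.2)]
  rw [countMeasure, h, integral_smul_measure, integral_finsetSum_measure fun i _ =>
    integrable_dirac (by simp)]
  simp only [integral_dirac, smul_eq_mul]
  congr 1
  rw [ENNReal.toReal_inv, ENNReal.toReal_add (by finiteness) (by simp), ENNReal.toReal_mul]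
  simp

variable [CompleteSpace H] {b : ℝ} {ψ : ℤ → H} {T : H →L[ℂ] EllTwo}

/-- The bound is uniform in `N`, which lets one Weierstrass approximation serve all finite sums.
Each eigenvalue is `‖S v‖²` for a unit eigenvector `v`. -/
theorem finEigenvalues_mem_Icc (hT : IsAnalysis ψ T) (hb : 0 ≤ b) (x : ℤ → Set.Icc (0 : ℝ) b)
    {κ : ℤ → ℝ} (hκ : ∀ n, κ n = x n) (N : ℕ) (i) :
    finEigenvalues ψ κ N i ∈ Set.Icc 0 (b * ‖T‖ ^ 2) := by
  set B := (finOpRan_isSelfAdjoint ψ κ N).isSymmetric.eigenvectorBasis rfl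
  have h1 := (finOpRan_isSelfAdjoint ψ κ N).isSymmetric.apply_eigenvectorBasis rfl i
  have h2 : finOp ψ κ N (B i : H) = (finEigenvalues ψ κ N i : ℂ) • (B i : H) :=
    congrArg Subtype.val h1
  have h3 : ‖(B i : H)‖ = 1 := B.norm_eq_one i
  rw [← sumOp_truncate x hT hb N hκ] at h2
  set l := finEigenvalues ψ κ N i
  set S := diagOp (truncate hb N x) ∘L T
  have h4 : inner ℂ (B i : H) (sumOp (truncate hb N x) T (B i : H)) = (l : ℂ) := by
    rw [h2, inner_smul_right, inner_self_eq_norm_sq_to_K, h3]; simp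
  have h5 : inner ℂ (B i : H) (sumOp (truncate hb N x) T (B i : H)) =
      ((‖S (B i)‖ ^ 2 : ℝ) : ℂ) := by
    change inner ℂ (B i : H) (adjoint S (S (B i))) = _
    rw [adjoint_inner_right, inner_self_eq_norm_sq_to_K]
    norm_cast
  have h6 : l = ‖S (B i)‖ ^ 2 := by
    have := h4.symm.trans h5
    exact_mod_cast this
  refine ⟨by rw [h6]; positivity, ?_⟩
  have h7 := (sumOp (truncate hb N x) T).le_of_opNorm_le (norm_sumOp_le _ T hb) (B i : H)
  rw [h2, norm_smul, h3, mul_one, mul_one, Complex.norm_real] at h7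
  exact (Real.le_norm_self l).trans h7

end FinOp

end

/-! ### Linear independence of the `ψ_n` and traces of powers -/

section

open ContinuousLinearMap Polynomial

variable {H : Type*} [NormedAddCommGroup H] [InnerProductSpace ℂ H]

section Independence

variable {ψ : ℤ → H}

/-- The norm of a linear combination depends only on the Gram matrix, which is translation
invariant. -/
theorem sum_smul_shift_eq_zero
    (hshift : ∀ n m : ℤ, inner ℂ (ψ (n + 1)) (ψ (m + 1)) = inner ℂ (ψ n) (ψ m))
    {s : Finset ℤ} {c : ℤ → ℂ} (h : ∑ n ∈ s, c n • ψ n = 0) (k : ℤ) :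
    ∑ n ∈ s, c n • ψ (n + k) = 0 := by
  rw [← inner_self_eq_zero (𝕜 := ℂ)] at h ⊢
  rw [← h]
  simp only [sum_inner, inner_sum, inner_smul_left, inner_smul_right, inner_shift hshift]

/-- Infinitely many unit vectors of a Bessel family do not lie in a finite-dimensional subspace. -/
theorem exists_notMem_of_finiteDimensional (hnorm : ∀ n, ‖ψ n‖ = 1)
    {G : EllTwo →L[ℂ] EllTwo} (hG : IsGramOperator ψ G) (V : Submodule ℂ H)
    [FiniteDimensional ℂ V] : ∃ k : ℕ, ψ k ∉ V := by
  by_contra! hV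
  let u := stdOrthonormalBasis ℂ V
  have hk : ∀ k : ℕ, ∑ i, ‖inner ℂ (ψ k) (u i : H)‖ ^ 2 = 1 := fun k => by
    have h := u.sum_sq_norm_inner_left ⟨ψ k, hV k⟩
    simp only [Submodule.coe_inner, Submodule.coe_norm, hnorm, one_pow] at h
    exact h
  -- If all `ψ k` lay in `V`, the first `K` unit vectors would contribute `K` in total, while Bessel
  -- allows at most `‖G‖` for each of the finitely many basis vectors.
  have hbound : ∀ K : ℕ, (K : ℝ) ≤ Module.finrank ℂ V * ‖G‖ := fun K => by
    calc (K : ℝ) = ∑ k ∈ Finset.range K, ∑ i, ‖inner ℂ (ψ k) (u i : H)‖ ^ 2 := by simp [hk]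
      _ = ∑ i, ∑ k ∈ Finset.range K, ‖inner ℂ (ψ k) (u i : H)‖ ^ 2 := Finset.sum_comm
      _ ≤ ∑ i : Fin (Module.finrank ℂ V), ‖G‖ := Finset.sum_le_sum fun i _ => by
        have h := sum_norm_inner_sq_le hG ((Finset.range K).map Nat.castEmbedding) (u i : H)
        rw [Finset.sum_map] at h
        have h1 : ‖(u i : H)‖ = 1 := u.norm_eq_one i
        simpa [h1] using h
      _ = _ := by simp
  obtain ⟨K, hK⟩ := exists_nat_gt ((Module.finrank ℂ V : ℝ) * ‖G‖)
  exact absurd (hbound K) (not_le.2 hK)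

/-- Translates of one linear relation form a recursion expressing `ψ k` through the `M - m`
preceding vectors. All `ψ k` with `k ≥ 0` then lie in the span of `ψ (m - M), …, ψ (-1)`, which is
impossible for a Bessel family of unit vectors. -/
theorem linearIndependent_of_isGramOperator (hnorm : ∀ n, ‖ψ n‖ = 1)
    {G : EllTwo →L[ℂ] EllTwo} (hG : IsGramOperator ψ G)
    (hshift : ∀ n m : ℤ, inner ℂ (ψ (n + 1)) (ψ (m + 1)) = inner ℂ (ψ n) (ψ m)) :
    LinearIndependent ℂ ψ := by
  rw [linearIndependent_iff']
  by_contra! hdep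
  obtain ⟨s, c, hsum, i, hi, hci⟩ := hdep
  let F := s.filter fun n => c n ≠ 0
  have hF : F.Nonempty := ⟨i, Finset.mem_filter.2 ⟨hi, hci⟩⟩
  have hsumF : ∑ n ∈ F, c n • ψ n = 0 := by
    rw [← hsum, Finset.sum_filter]
    refine Finset.sum_congr rfl fun n _ => ?_
    split_ifs with h
    · rfl
    · rw [not_not.1 h, zero_smul]
  set M := F.max' hF
  set m := F.min' hF
  have hM : M ∈ F := F.max'_mem hF
  have hcM : c M ≠ 0 := (Finset.mem_filter.1 hM).2
  let V : Submodule ℂ H := Submodule.span ℂ (ψ '' (Finset.Ico (m - M) 0 : Finset ℤ))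
  have : FiniteDimensional ℂ V :=
    FiniteDimensional.span_of_finite ℂ ((Finset.finite_toSet _).image ψ)
  obtain ⟨k, hk⟩ := exists_notMem_of_finiteDimensional hnorm hG V
  refine hk ?_
  clear hk
  induction k using Nat.strong_induction_on with
  | _ k ih =>
    -- The translation by `k - M` brings the top index `M` of the relation to `k`.
    have h := sum_smul_shift_eq_zero hshift hsumF (k - M)
    rw [← Finset.add_sum_erase F _ hM, add_sub_cancel] at h
    have h2 : ψ k = (-(c M)⁻¹) • ∑ n ∈ F.erase M, c n • ψ (n + (k - M)) := by
      rw [eq_neg_of_add_eq_zero_right h, smul_neg, neg_smul, neg_neg, inv_smul_smul₀ hcM]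
    rw [h2]
    refine V.smul_mem _ (V.sum_mem fun n hn => V.smul_mem _ ?_)
    have hnF := Finset.mem_of_mem_erase hn
    have h3 : m ≤ n := F.min'_le n hnF
    have h4 : n < M := lt_of_le_of_ne (F.le_max' n hnF) (Finset.ne_of_mem_erase hn)
    rcases lt_or_ge (n + (k - M)) 0 with h5 | h5
    · refine Submodule.subset_span ⟨_, ?_, rfl⟩
      rw [SetLike.mem_coe, Finset.mem_Ico]
      omega
    · obtain ⟨j, hj⟩ := Int.eq_ofNat_of_zero_le h5
      rw [hj]
      exact ih j (by omega)

end Independence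

section Traces

variable [CompleteSpace H] {b : ℝ} {ψ : ℤ → H} {T : H →L[ℂ] EllTwo}

/-- A finite-dimensional range is its own double orthogonal complement. If `y` is orthogonal to the
range of `S*S` then `‖S y‖² = 0`, so `y` is orthogonal to `S* c`. -/
theorem adjoint_apply_mem_range {E F : Type*} [NormedAddCommGroup E] [InnerProductSpace ℂ E]
    [CompleteSpace E] [NormedAddCommGroup F] [InnerProductSpace ℂ F] [CompleteSpace F]
    {S : E →L[ℂ] F} {A : E →L[ℂ] E} (hA : adjoint S ∘L S = A)
    [FiniteDimensional ℂ (LinearMap.range (A : E →ₗ[ℂ] E))] (c : F) :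
    adjoint S c ∈ LinearMap.range (A : E →ₗ[ℂ] E) := by
  rw [← Submodule.orthogonal_orthogonal (LinearMap.range (A : E →ₗ[ℂ] E)),
    Submodule.mem_orthogonal]
  intro y hy
  have h1 : inner ℂ (adjoint S (S y)) y = (0 : ℂ) :=
    (Submodule.mem_orthogonal _ y).1 hy _ ⟨y, by rw [← hA]; rfl⟩
  rw [adjoint_inner_left, inner_self_eq_zero] at h1
  rw [adjoint_inner_right, h1, inner_zero_left]

theorem traceFun_pow {E : Type*} [NormedAddCommGroup E] [InnerProductSpace ℂ E] [CompleteSpace E]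
    {A : E →L[ℂ] E} (hA : IsSelfAdjoint A) (p : ℕ) :
    traceFun A (fun t => t ^ p) = LinearMap.trace ℂ E ((A ^ p : E →L[ℂ] E) : E →ₗ[ℂ] E) := by
  rw [traceFun, cfc_pow_id (R := ℝ) A p hA]

theorem finRan_eq_span (hT : IsAnalysis ψ T) (hb : 0 ≤ b) {x : ℤ → Set.Icc (0 : ℝ) b}
    (hx : ∀ n, 0 < (x n : ℝ)) {κ : ℤ → ℝ} (hκ : ∀ n, κ n = x n) (N : ℕ) :
    finRan ψ κ N = Submodule.span ℂ (ψ '' (Finset.Icc (-(N : ℤ)) (N : ℤ) : Finset ℤ)) := by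
  refine le_antisymm (finRan_le_span ψ κ N) (Submodule.span_le.2 ?_)
  rintro _ ⟨n, hn, rfl⟩
  have h : _ ∈ finRan ψ κ N := adjoint_apply_mem_range (sumOp_truncate x hT hb N hκ) (stdVec n)
  rw [adjoint_comp, adjoint_diagOp, coe_comp, Function.comp_apply, diagOp_stdVec, map_smul,
    hT.adjoint_stdVec, truncate, if_pos (by exact_mod_cast hn)] at h
  have h0 : (Real.sqrt (x n) : ℂ) ≠ 0 := by exact_mod_cast (Real.sqrt_pos.2 (hx n)).ne'
  exact (Submodule.smul_mem_iff _ h0).1 h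

/-- The exact rank gives the counting measures total mass 1; this is the zeroth moment. -/
theorem finrank_finRan (hT : IsAnalysis ψ T) (hli : LinearIndependent ℂ ψ) (hb : 0 ≤ b)
    {x : ℤ → Set.Icc (0 : ℝ) b} (hx : ∀ n, 0 < (x n : ℝ)) {κ : ℤ → ℝ} (hκ : ∀ n, κ n = x n)
    (N : ℕ) : Module.finrank ℂ (finRan ψ κ N) = 2 * N + 1 := by
  have hspan : finRan ψ κ N = Submodule.span ℂ (Set.range
      (ψ ∘ (Subtype.val : (Finset.Icc (-(N : ℤ)) (N : ℤ) : Finset ℤ) → ℤ))) := by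
    rw [finRan_eq_span hT hb hx hκ N, Set.range_comp]
    congr 2
    exact Subtype.range_val.symm
  rw [hspan, finrank_span_eq_card (hli.comp _ Subtype.val_injective), Fintype.card_coe,
    Int.card_Icc]
  omega

omit [CompleteSpace H] in
theorem finOpRan_eq_sum (ψ : ℤ → H) {κ : ℤ → ℝ} {N : ℕ} {w : ℤ → finRan ψ κ N}
    (hw : ∀ y : H, finOp ψ κ N y =
      ∑ n ∈ Finset.Icc (-(N : ℤ)) N, (inner ℂ (w n : H) y : ℂ) • (w n : H)) :
    finOpRan ψ κ N = ∑ n ∈ Finset.Icc (-(N : ℤ)) N, InnerProductSpace.rankOne ℂ (w n) (w n) := by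
  ext y
  rw [sum_apply, Submodule.coe_sum]
  exact hw y

/-- Moments of the eigenvalues as diagonal sums. -/
theorem sum_finEigenvalues_pow (hT : IsAnalysis ψ T) (hli : LinearIndependent ℂ ψ) (hb : 0 ≤ b)
    {x : ℤ → Set.Icc (0 : ℝ) b} (hx : ∀ n, 0 < (x n : ℝ)) {κ : ℤ → ℝ} (hκ : ∀ n, κ n = x n)
    (N p : ℕ) : ∑ i, finEigenvalues ψ κ N i ^ p =
      ∑ n ∈ Finset.Icc (-(N : ℤ)) N,
        diagElem (gramOp (truncate hb N x) T) (fun t => t ^ p) n := by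
  set S := diagOp (truncate hb N x) ∘L T with hS
  have hP : sumOp (truncate hb N x) T = finOp ψ κ N := sumOp_truncate x hT hb N hκ
  -- For `p = 0` both sides count: the rank on the left, the sites of `[-N, N]` on the right. For
  -- positive powers the identity is cyclicity of the trace.
  rcases Nat.eq_zero_or_pos p with rfl | hp
  · have h1 : ∀ n, diagElem (gramOp (truncate hb N x) T) (fun t => t ^ 0) n = 1 := fun n => by
      rw [diagElem_pow (isSelfAdjoint_gramOp _ T), pow_zero]
      change (inner ℂ (stdVec n) (stdVec n)).re = 1
      rw [inner_self_eq_norm_sq_to_K, norm_stdVec]; simp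
    rw [Finset.sum_congr rfl fun n _ => h1 n]
    simp only [pow_zero, Finset.sum_const, Finset.card_univ, Fintype.card_fin, nsmul_eq_mul,
      mul_one, finrank_finRan hT hli hb hx hκ N, Int.card_Icc]
    congr 1
    omega
  · obtain ⟨p, rfl⟩ := Nat.exists_eq_add_of_lt hp
    rw [zero_add]
    have hmem : ∀ n, adjoint S (stdVec n) ∈ finRan ψ κ N := fun n =>
      adjoint_apply_mem_range hP (stdVec n)
    let w : ℤ → finRan ψ κ N := fun n => ⟨adjoint S (stdVec n), hmem n⟩
    have hB := finOpRan_eq_sum ψ (κ := κ) (N := N) (w := w) fun y => by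
      have h := hasSum_sumOp (truncate hb N x) hT y
      rw [hP] at h
      have hSn : ∀ n, adjoint S (stdVec n) = (Real.sqrt (truncate hb N x n) : ℂ) • ψ n :=
        fun n => by
          rw [hS, adjoint_comp, adjoint_diagOp, coe_comp, Function.comp_apply, diagOp_stdVec,
            map_smul, hT.adjoint_stdVec]
      refine h.unique ?_
      have hterm : ∀ n, (((truncate hb N x n : ℝ)) : ℂ) •
          InnerProductSpace.rankOne ℂ (ψ n) (ψ n) y =
          (inner ℂ (w n : H) y : ℂ) • (w n : H) := fun n => by
        change _ = (inner ℂ (adjoint S (stdVec n)) y : ℂ) • adjoint S (stdVec n)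
        rw [hSn, inner_smul_left, Complex.conj_ofReal, InnerProductSpace.rankOne_apply, smul_smul,
          smul_smul, mul_right_comm, ← Complex.ofReal_mul,
          Real.mul_self_sqrt (truncate hb N x n).2.1]
      rw [funext hterm]
      refine hasSum_sum_of_ne_finset_zero fun n hn => ?_
      rw [← hterm, truncate, if_neg hn]
      simp
    have hwS : ∀ n, ∀ q : ℕ, (((finOpRan ψ κ N) ^ q) (w n) : H) =
        (sumOp (truncate hb N x) T ^ q) (adjoint S (stdVec n)) := fun n q => by
      induction q with
      | zero => rfl
      | succ q ih =>
        rw [pow_succ', pow_succ', mul_apply_eq_comp, mul_apply_eq_comp, ← ih, hP]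
        rfl
    -- The intertwining `S (S*S)^q S* = (SS*)^(q+1)`.
    have hSS : ∀ q : ℕ, ∀ c, S ((sumOp (truncate hb N x) T ^ q) (adjoint S c)) =
        (gramOp (truncate hb N x) T ^ (q + 1)) c := fun q => by
      induction q with
      | zero => intro c; rw [pow_one]; rfl
      | succ q ih =>
        intro c
        rw [pow_succ _ (q + 1), mul_apply_eq_comp, ← ih, pow_succ _ q, mul_apply_eq_comp]
        rfl
    have htr : traceFun (finOpRan ψ κ N) (fun t => t ^ (p + 1)) =
        ∑ n ∈ Finset.Icc (-(N : ℤ)) N,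
          inner ℂ (stdVec n) ((gramOp (truncate hb N x) T ^ (p + 1)) (stdVec n)) := by
      -- Splitting off one factor as a sum of rank-one operators turns the trace into a finite sum
      -- of inner products.
      have h1 : finOpRan ψ κ N ^ (p + 1) = ∑ n ∈ Finset.Icc (-(N : ℤ)) N,
          InnerProductSpace.rankOne ℂ ((finOpRan ψ κ N ^ p) (w n)) (w n) := by
        rw [pow_succ]
        conv_lhs => rw [hB]
        rw [Finset.mul_sum, ← hB]
        refine Finset.sum_congr rfl fun n _ => ?_
        ext y
        simp [InnerProductSpace.rankOne_apply]
      rw [traceFun_pow (finOpRan_isSelfAdjoint ψ κ N), h1, toLinearMap_sum,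
        map_sum]
      refine Finset.sum_congr rfl fun n _ => ?_
      rw [InnerProductSpace.trace_rankOne, ← hSS, ← hwS]
      exact adjoint_inner_left S _ (stdVec n)
    rw [traceFun_eq_sum_eigenvalues (finOpRan_isSelfAdjoint ψ κ N) rfl (by fun_prop)] at htr
    have h2 := congrArg Complex.re htr
    rw [Complex.ofReal_re, Complex.re_sum] at h2
    refine h2.trans (Finset.sum_congr rfl fun n _ => ?_)
    rw [diagElem_pow (isSelfAdjoint_gramOp _ T)]

end Traces

end

/-! ### Edge effects, the moment method, and spectrum versus support -/

section

open ContinuousLinearMap Polynomial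

section Truncation

variable {b : ℝ}

/-- Cutting a sequence off outside the window of an average does not change the limit. -/
theorem tendsto_average_truncate (hb : 0 ≤ b) {F : (ℤ → Set.Icc (0 : ℝ) b) → ℝ}
    (hF : Continuous F) {x : ℤ → Set.Icc (0 : ℝ) b} {c : ℝ}
    (h : Tendsto (fun N : ℕ => (2 * (N : ℝ) + 1)⁻¹ *
      ∑ n ∈ Finset.Icc (-(N : ℤ)) N, F (shiftSeq n x)) atTop (𝓝 c)) :
    Tendsto (fun N : ℕ => (2 * (N : ℝ) + 1)⁻¹ *
      ∑ n ∈ Finset.Icc (-(N : ℤ)) N, F (shiftSeq n (truncate hb N x))) atTop (𝓝 c) := by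
  obtain ⟨B, hB⟩ : ∃ B, ∀ x, |F x| ≤ B := by
    obtain ⟨B, hB⟩ := isCompact_univ.exists_bound_of_continuousOn hF.continuousOn
    exact ⟨B, fun x => hB x trivial⟩
  have hB0 : 0 ≤ B := (abs_nonneg _).trans (hB x)
  suffices hdiff : Tendsto (fun N : ℕ => (2 * (N : ℝ) + 1)⁻¹ * ∑ n ∈ Finset.Icc (-(N : ℤ)) N,
      (F (shiftSeq n (truncate hb N x)) - F (shiftSeq n x))) atTop (𝓝 0) by
    have := hdiff.add h
    rw [zero_add] at this
    refine this.congr fun N => ?_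
    rw [← mul_add, ← Finset.sum_add_distrib]
    simp
  rw [Metric.tendsto_atTop]
  intro ε hε
  obtain ⟨R, hR⟩ := exists_window hF (half_pos hε)
  -- Only the `2R` sites within `R` of the edges see the cutoff appreciably, each with error at most
  -- `2B`; this `N₀` makes their total `4RB` less than `ε N`.
  obtain ⟨N₀, hN₀⟩ := exists_nat_gt (4 * R * B / ε)
  refine ⟨max N₀ R, fun N hN => ?_⟩
  have hNR : R ≤ N := (le_max_right _ _).trans hN
  have hNN : (N₀ : ℝ) ≤ N := by exact_mod_cast (le_max_left _ _).trans hN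
  rw [dist_zero_right, Real.norm_eq_abs, abs_mul, abs_of_pos (by positivity : (0 : ℝ) <
    (2 * (N : ℝ) + 1)⁻¹), inv_mul_lt_iff₀ (by positivity)]
  set W := Finset.Icc (-((N : ℤ) - R)) ((N : ℤ) - R) with hW
  have hWsub : W ⊆ Finset.Icc (-(N : ℤ)) N := Finset.Icc_subset_Icc (by omega) (by omega)
  have hterm : ∀ n ∈ Finset.Icc (-(N : ℤ)) N,
      |F (shiftSeq n (truncate hb N x)) - F (shiftSeq n x)| ≤
        ε / 2 + if n ∈ W then 0 else 2 * B := fun n _ => by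
    split_ifs with hn
    · rw [add_zero]
      refine hR _ _ fun m hm => ?_
      rw [hW, Finset.mem_Icc] at hn
      rw [Finset.mem_Icc] at hm
      rw [shiftSeq, shiftSeq, truncate, if_pos (Finset.mem_Icc.2 (by omega))]
    · refine (abs_sub _ _).trans ?_
      linarith [hB (shiftSeq n (truncate hb N x)), hB (shiftSeq n x)]
  have hcard : ∑ n ∈ Finset.Icc (-(N : ℤ)) N, (if n ∈ W then 0 else 2 * B) = 2 * R * (2 * B) := by
    rw [← Finset.sum_sdiff hWsub, Finset.sum_congr rfl fun n hn =>
      if_neg (Finset.mem_sdiff.1 hn).2, Finset.sum_congr (s₁ := W) rfl fun n hn => if_pos hn,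
      Finset.sum_const_zero, add_zero, Finset.sum_const, nsmul_eq_mul,
      Finset.card_sdiff_of_subset hWsub, hW, Int.card_Icc, Int.card_Icc]
    congr 1
    have : ((N : ℤ) + 1 - -N).toNat - ((N : ℤ) - R + 1 - -((N : ℤ) - R)).toNat = 2 * R := by omega
    rw [this]
    push_cast
    ring
  refine (Finset.abs_sum_le_sum_abs _ _).trans_lt ((Finset.sum_le_sum hterm).trans_lt ?_)
  rw [Finset.sum_add_distrib, hcard, Finset.sum_const, Int.card_Icc, nsmul_eq_mul]
  have h1 : ((((N : ℤ) + 1 - -N).toNat : ℕ) : ℝ) = 2 * N + 1 := by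
    have : ((N : ℤ) + 1 - -N).toNat = 2 * N + 1 := by omega
    rw [this]; push_cast; ring
  rw [h1]
  have h2 : 4 * R * B < ε * N := by
    have := hN₀.trans_le hNN
    rwa [div_lt_iff₀ hε, mul_comm (N : ℝ)] at this
  nlinarith

end Truncation

section Weierstrass

/-- Convergence of the moments of uniformly bounded point measures implies convergence of the
integrals of all continuous functions. -/
theorem tendsto_of_moments {d : ℕ → ℕ} {l : ∀ N, Fin (d N) → ℝ} {w : ℕ → ℝ} {K : ℝ}
    (hl : ∀ N i, l N i ∈ Set.Icc 0 K) (hw0 : ∀ N, 0 ≤ w N) (hw : ∀ N, w N * d N = 1)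
    {ν : Measure ℝ} [IsProbabilityMeasure ν] (hν : ν (Set.Icc 0 K)ᶜ = 0)
    (hint : ∀ f : ℝ → ℝ, Continuous f → Integrable f ν)
    (hmom : ∀ p : ℕ, Tendsto (fun N => w N * ∑ i, l N i ^ p) atTop (𝓝 (∫ t, t ^ p ∂ν)))
    {f : ℝ → ℝ} (hf : Continuous f) :
    Tendsto (fun N => w N * ∑ i, f (l N i)) atTop (𝓝 (∫ t, f t ∂ν)) := by
  have hpoly : ∀ q : ℝ[X], Tendsto (fun N => w N * ∑ i, q.eval (l N i)) atTop
      (𝓝 (∫ t, q.eval t ∂ν)) := fun q => by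
    have h1 := tendsto_finsetSum (Finset.range (q.natDegree + 1)) fun i _ =>
      (hmom i).const_mul (q.coeff i)
    have h2 : ∫ t, q.eval t ∂ν =
        ∑ i ∈ Finset.range (q.natDegree + 1), q.coeff i * ∫ t, t ^ i ∂ν := by
      simp only [eval_eq_sum_range]
      rw [integral_finsetSum _ fun i _ => hint _ (by fun_prop)]
      simp only [integral_const_mul]
    rw [h2]
    refine h1.congr fun N => ?_
    simp only [eval_eq_sum_range]
    rw [Finset.sum_comm, Finset.mul_sum]
    refine Finset.sum_congr rfl fun i _ => ?_
    rw [← Finset.mul_sum]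
    ring
  rw [Metric.tendsto_atTop]
  intro ε hε
  obtain ⟨q, hq⟩ := exists_polynomial_near_of_continuousOn 0 K f hf.continuousOn (ε / 4)
    (by positivity)
  obtain ⟨N₀, hN₀⟩ := Metric.tendsto_atTop.1 (hpoly q) (ε / 4) (by positivity)
  refine ⟨N₀, fun N hN => ?_⟩
  have h1 := hN₀ N hN
  have h2 : |w N * ∑ i, q.eval (l N i) - w N * ∑ i, f (l N i)| ≤ ε / 4 := by
    rw [← mul_sub, ← Finset.sum_sub_distrib, abs_mul, abs_of_nonneg (hw0 N)]
    calc _ ≤ w N * ∑ _i : Fin (d N), ε / 4 := by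
          refine mul_le_mul_of_nonneg_left ((Finset.abs_sum_le_sum_abs _ _).trans ?_) (hw0 N)
          exact Finset.sum_le_sum fun i _ => (hq _ (hl N i)).le
      _ = w N * d N * (ε / 4) := by simp; ring
      _ = _ := by rw [hw, one_mul]
  have h3 : |∫ t, q.eval t ∂ν - ∫ t, f t ∂ν| ≤ ε / 4 := by
    rw [← integral_sub (hint _ q.continuous) (hint _ hf)]
    have hae : ∀ᵐ t ∂ν, ‖q.eval t - f t‖ ≤ ε / 4 := by
      have : ∀ᵐ t ∂ν, t ∈ Set.Icc 0 K := hν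
      filter_upwards [this] with t ht using (hq t ht).le
    simpa using norm_integral_le_of_norm_le_const hae
  rw [Real.dist_eq] at h1 ⊢
  rw [abs_lt] at *
  rw [abs_le] at h2 h3
  constructor <;> linarith [h1.1, h1.2, h2.1, h2.2, h3.1, h3.2]

end Weierstrass

section Spectrum

variable {E : Type*} [NormedAddCommGroup E] [InnerProductSpace ℂ E] [CompleteSpace E]

theorem cfcForm_eq_zero_of_eqOn {A : E →L[ℂ] E} {f : ℝ → ℝ}
    (h : ∀ t ∈ spectrum ℝ A, f t = 0) (v : E) : cfcForm A f v = 0 := by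
  rw [cfcForm_congr (g := fun _ => 0) (fun t ht => h t ht), cfcForm, cfc_const_zero]
  simp

/-- For `f ≥ 0` the form is `‖√f(A) v‖²`. If it vanished at every `e i`, then `f(A) = 0`,
contradicting the spectral mapping theorem at `t`. -/
theorem exists_cfcForm_ne_zero {A : E →L[ℂ] E} (hA : IsSelfAdjoint A) {f : ℝ → ℝ}
    (hf : Continuous f) (hf0 : ∀ t, 0 ≤ f t) {t : ℝ} (ht : t ∈ spectrum ℝ A) (hft : f t ≠ 0)
    {ι : Type*} {e : ι → E} (he : ∀ B : E →L[ℂ] E, (∀ i, B (e i) = 0) → B = 0) :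
    ∃ i, cfcForm A f (e i) ≠ 0 := by
  by_contra! h
  have hsqrt : cfc f A = cfc (fun s => Real.sqrt (f s)) A * cfc (fun s => Real.sqrt (f s)) A := by
    rw [← cfc_mul (a := A) (fun s => Real.sqrt (f s)) (fun s => Real.sqrt (f s))]
    exact cfc_congr fun s _ => (Real.mul_self_sqrt (hf0 s)).symm
  have hsa : IsSelfAdjoint (cfc (fun s => Real.sqrt (f s)) A) := cfc_predicate _ A
  have hzero : cfc f A = 0 := he _ fun i => by
    have h1 := h i
    rw [cfcForm, hsqrt, mul_apply_eq_comp, ← adjoint_inner_left, hsa.adjoint_eq] at h1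
    have h2 : cfc (fun s => Real.sqrt (f s)) A (e i) = 0 := by
      have h3 := inner_self_eq_norm_sq (𝕜 := ℂ) (cfc (fun s => Real.sqrt (f s)) A (e i))
      have h4 : ‖cfc (fun s => Real.sqrt (f s)) A (e i)‖ ^ 2 = 0 := h3.symm.trans h1
      simpa using h4
    rw [hsqrt, mul_apply_eq_comp, h2, map_zero]
  have hmem : f t ∈ spectrum ℝ (cfc f A) := by
    rw [cfc_map_spectrum f A]
    exact ⟨t, ht, rfl⟩
  rw [hzero] at hmem
  have : Nontrivial E := by
    by_contra hE
    rw [not_nontrivial_iff_subsingleton] at hE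
    have : Subsingleton (E →L[ℂ] E) := ⟨fun A B => by ext v; exact Subsingleton.elim _ _⟩
    rw [spectrum.of_subsingleton] at ht
    exact ht
  rw [spectrum.zero_eq] at hmem
  exact hft hmem

theorem spectrum_complex_eq {A : E →L[ℂ] E} (hA : IsSelfAdjoint A) :
    spectrum ℂ A = Complex.ofReal '' spectrum ℝ A :=
  (hA.spectrumRestricts.algebraMap_image).symm

/-- A tent function that is positive exactly on `(p, r)`. -/
def tent (p r t : ℝ) : ℝ := max 0 (min (t - p) (r - t))

theorem continuous_tent (p r : ℝ) : Continuous (tent p r) := by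
  unfold tent; fun_prop

theorem tent_nonneg (p r t : ℝ) : 0 ≤ tent p r t := le_max_left _ _

theorem tent_ne_zero_iff {p r t : ℝ} : tent p r t ≠ 0 ↔ t ∈ Set.Ioo p r := by
  rw [← (tent_nonneg p r t).lt_iff_ne', tent, lt_max_iff, lt_min_iff, sub_pos, sub_pos]
  simp

theorem exists_rat_Ioo_subset {t : ℝ} {U : Set ℝ} (hU : U ∈ 𝓝 t) :
    ∃ p r : ℚ, t ∈ Set.Ioo (p : ℝ) r ∧ Set.Ioo (p : ℝ) r ⊆ U := by
  obtain ⟨l, u, htlu, hsub⟩ := mem_nhds_iff_exists_Ioo_subset.1 hU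
  obtain ⟨p, hp1, hp2⟩ := exists_rat_btwn htlu.1
  obtain ⟨r, hr1, hr2⟩ := exists_rat_btwn htlu.2
  exact ⟨p, r, ⟨hp2, hr1⟩, (Set.Ioo_subset_Ioo hp1.le hr2.le).trans hsub⟩

/-- A point in the spectrum but not in the support has a tent of zero `ν`-integral around it with
some non-zero diagonal element, against `hzero`. A point in the support but not in the spectrum has
a tent that `A` annihilates but of positive integral, against `havg`. Rational endpoints keep the
tests countable. -/
theorem spectrum_eq_support {A : EllTwo →L[ℂ] EllTwo} (hA : IsSelfAdjoint A) {ν : Measure ℝ}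
    [IsProbabilityMeasure ν] (hint : ∀ f : ℝ → ℝ, Continuous f → Integrable f ν)
    (havg : ∀ p r : ℚ, Tendsto (fun N : ℕ => (2 * (N : ℝ) + 1)⁻¹ *
      ∑ n ∈ Finset.Icc (-(N : ℤ)) N, diagElem A (tent p r) n) atTop (𝓝 (∫ t, tent p r t ∂ν)))
    (hzero : ∀ p r : ℚ, ∫ t, tent p r t ∂ν = 0 → ∀ n, diagElem A (tent p r) n = 0) :
    spectrum ℝ A = ν.support := by
  ext t
  constructor
  · intro ht
    by_contra hsupp
    obtain ⟨U, hU, hνU⟩ := Measure.notMem_support_iff_exists.1 hsupp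
    obtain ⟨p, r, htpr, hsub⟩ := exists_rat_Ioo_subset hU
    have h0 : ∫ s, tent p r s ∂ν = 0 := by
      refine integral_eq_zero_of_ae ?_
      refine measure_mono_null (fun s hs => ?_) hνU
      exact hsub (tent_ne_zero_iff.1 hs)
    obtain ⟨n, hn⟩ := exists_cfcForm_ne_zero hA (continuous_tent p r) (tent_nonneg p r) ht
      (tent_ne_zero_iff.2 htpr) (e := stdVec)
      (fun B hB => ext_stdVec fun n => by rw [hB]; rfl)
    exact hn (hzero p r h0 n)
  · intro ht
    by_contra hspec
    have hcl : IsClosed (spectrum ℝ A) := spectrum.isClosed A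
    obtain ⟨p, r, htpr, hsub⟩ := exists_rat_Ioo_subset (hcl.isOpen_compl.mem_nhds hspec)
    have h0 : ∀ n, diagElem A (tent p r) n = 0 := fun n =>
      cfcForm_eq_zero_of_eqOn (fun s hs => by
        by_contra hne
        exact hsub (tent_ne_zero_iff.1 hne) hs) _
    have hlim := havg p r
    simp only [h0, Finset.sum_const_zero, mul_zero] at hlim
    have hI : ∫ s, tent p r s ∂ν = 0 := tendsto_nhds_unique hlim tendsto_const_nhds
    have hpos : 0 < ∫ s, tent p r s ∂ν := by
      rw [integral_pos_iff_support_of_nonneg (tent_nonneg p r) (hint _ (continuous_tent p r))]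
      have hs : Function.support (tent p r) = Set.Ioo (p : ℝ) r := by
        ext s; exact tent_ne_zero_iff
      rw [hs]
      exact (Measure.mem_support_iff_forall t).1 ht _ (Ioo_mem_nhds htpr.1 htpr.2)
    exact hpos.ne' hI

end Spectrum

end

/-! ### From the compact sample space to the given one, and almost sure limits -/

section

open ContinuousLinearMap Polynomial

theorem exists_Icc_of_isCompact_support {P₀ : Measure ℝ} [IsProbabilityMeasure P₀]
    (hcompact : IsCompact P₀.support) (hpos : P₀.support ⊆ Set.Ioi 0) :
    ∃ a b : ℝ, 0 < a ∧ 1 ≤ b ∧ ∀ᵐ t ∂P₀, t ∈ Set.Icc a b := by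
  have hne : P₀.support.Nonempty := Measure.nonempty_support (IsProbabilityMeasure.ne_zero P₀)
  obtain ⟨a, ha⟩ := hcompact.exists_isLeast hne
  obtain ⟨b, hb⟩ := hcompact.bddAbove
  -- The bound is raised to at least 1 so that the constant sequence 1 is an admissible sequence in
  -- `[0, b]`.
  refine ⟨a, max b 1, hpos ha.1, le_max_right _ _, ?_⟩
  filter_upwards [Measure.support_mem_ae (μ := P₀)] with t ht
  exact ⟨ha.2 ht, (hb ht).trans (le_max_left _ _)⟩

/-- Coordinatewise projection of a real sequence to `[0, b]`. -/
def clamp {b : ℝ} (hb : 0 ≤ b) (κ : ℤ → ℝ) : ℤ → Set.Icc (0 : ℝ) b :=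
  fun n => Set.projIcc 0 b hb (κ n)

theorem clamp_apply {b : ℝ} (hb : 0 ≤ b) {κ : ℤ → ℝ} {a : ℝ} (ha : 0 ≤ a)
    (hκ : ∀ n, κ n ∈ Set.Icc a b) (n : ℤ) : κ n = clamp hb κ n := by
  have h : κ n ∈ Set.Icc 0 b := ⟨ha.trans (hκ n).1, (hκ n).2⟩
  rw [clamp, Set.projIcc_of_mem hb h]

theorem measurable_clamp {b : ℝ} (hb : 0 ≤ b) : Measurable (clamp hb) :=
  measurable_pi_lambda _ fun n =>
    continuous_projIcc.measurable.comp (measurable_pi_apply n)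

theorem map_clamp {b : ℝ} (hb : 0 ≤ b) (P₀ : Measure ℝ) [IsProbabilityMeasure P₀] :
    (Measure.infinitePi fun _ : ℤ => P₀).map (clamp hb) =
      Measure.infinitePi fun _ : ℤ => P₀.map (Set.projIcc 0 b hb) :=
  Measure.infinitePi_map_pi (μ := fun _ : ℤ => P₀) fun _ => continuous_projIcc.measurable

theorem identDistrib_projIcc {P₀ : Measure ℝ} [IsProbabilityMeasure P₀] {a b : ℝ} (hb : 0 ≤ b)
    (ha : 0 ≤ a) (hab : ∀ᵐ t ∂P₀, t ∈ Set.Icc a b) :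
    IdentDistrib (fun κ : ℤ → ℝ => κ 0) (fun t : Set.Icc (0 : ℝ) b => (t : ℝ))
      (Measure.infinitePi fun _ : ℤ => P₀) (P₀.map (Set.projIcc 0 b hb)) := by
  refine ⟨(measurable_pi_apply 0).aemeasurable, measurable_subtype_coe.aemeasurable, ?_⟩
  rw [Measure.map_map measurable_subtype_coe continuous_projIcc.measurable,
    (measurePreserving_eval_infinitePi (fun _ : ℤ => P₀) 0).map_eq]
  have : (Subtype.val ∘ Set.projIcc 0 b hb) =ᵐ[P₀] id := by
    filter_upwards [hab] with t ht
    rw [Function.comp_apply, Set.projIcc_of_mem hb ⟨ha.trans ht.1, ht.2⟩, id]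
  rw [Measure.map_congr this, Measure.map_id]

/-- Away from 0 the factors `S*S` and `SS*` share their spectrum; 0 is decided by `T` alone. -/
theorem spectrum_sumOp {H : Type*} [NormedAddCommGroup H] [InnerProductSpace ℂ H]
    [CompleteSpace H] {T : H →L[ℂ] EllTwo} {b a : ℝ} {x : ℤ → Set.Icc (0 : ℝ) b} (ha : 0 < a)
    (hx : ∀ n, a ≤ x n) :
    spectrum ℂ (sumOp x T) =
      Complex.ofReal '' ((spectrum ℝ (gramOp x T) \ {0}) ∪ {t | t = 0 ∧ ¬ IsBddBelowOp T}) := by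
  have hspec := spectrum_complex_eq (isSelfAdjoint_gramOp x T)
  ext z
  rcases eq_or_ne z 0 with rfl | hz
  · rw [spectrum.zero_mem_iff, isUnit_sumOp_iff ha hx]
    constructor
    · intro h
      exact ⟨0, Or.inr ⟨rfl, h⟩, Complex.ofReal_zero⟩
    · rintro ⟨t, ht, ht0⟩
      rw [Complex.ofReal_eq_zero] at ht0
      subst ht0
      rcases ht with ht | ht
      · exact absurd rfl ht.2
      · exact ht.2
  · rw [sumOp, mem_spectrum_comp_iff hz]
    change z ∈ spectrum ℂ (gramOp x T) ↔ _
    rw [hspec]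
    constructor
    · rintro ⟨t, ht, rfl⟩
      exact ⟨t, Or.inl ⟨ht, fun h => hz (by rw [h]; exact Complex.ofReal_zero)⟩, rfl⟩
    · rintro ⟨t, ht | ht, rfl⟩
      · exact ⟨t, ht.1, rfl⟩
      · exact absurd (by rw [ht.1]; exact Complex.ofReal_zero) hz

section DensityOfStates

variable {H : Type*} [NormedAddCommGroup H] [InnerProductSpace ℂ H] [CompleteSpace H]
  {ψ : ℤ → H} {T : H →L[ℂ] EllTwo} {b : ℝ} {μ : Measure (Set.Icc (0 : ℝ) b)}
  [IsProbabilityMeasure μ] {ν : Measure ℝ} [IsProbabilityMeasure ν]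

theorem integrable_of_measure_compl_Icc {K : ℝ} (hνK : ν (Set.Icc 0 K)ᶜ = 0) {f : ℝ → ℝ}
    (hf : Continuous f) : Integrable f ν := by
  obtain ⟨C, hC⟩ := isCompact_Icc.exists_bound_of_continuousOn (hf.continuousOn (s := Set.Icc 0 K))
  have hνae : ∀ᵐ t ∂ν, t ∈ Set.Icc 0 K := hνK
  refine Integrable.of_bound hf.aestronglyMeasurable C ?_
  filter_upwards [hνae] with t ht using hC t ht

variable (hb : 0 ≤ b) (hνint : ∀ f : ℝ → ℝ, Continuous f →
    ∫ t, f t ∂ν = ∫ x, diagElem (gramOp x T) f 0 ∂(Measure.infinitePi fun _ : ℤ => μ))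
include hb hνint

omit [IsProbabilityMeasure ν] in
theorem ae_tendsto_average_diagElem {f : ℝ → ℝ} (hf : Continuous f) :
    ∀ᵐ x ∂(Measure.infinitePi fun _ : ℤ => μ), Tendsto (fun N : ℕ => (2 * (N : ℝ) + 1)⁻¹ *
      ∑ n ∈ Finset.Icc (-(N : ℤ)) N, diagElem (gramOp (shiftSeq n x) T) f 0) atTop
      (𝓝 (∫ t, f t ∂ν)) := by
  rw [hνint f hf]
  exact ae_tendsto_average μ (continuous_diagElem T hb hf 0)

omit [IsProbabilityMeasure ν] in
theorem ae_diagElem_eq_zero {f : ℝ → ℝ} (hf : Continuous f) (hf0 : ∀ t, 0 ≤ f t)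
    (h : ∫ t, f t ∂ν = 0) (n : ℤ) : ∀ᵐ x ∂(Measure.infinitePi fun _ : ℤ => μ),
      diagElem (gramOp (shiftSeq n x) T) f 0 = 0 := by
  rw [hνint f hf] at h
  have h1 := (integral_eq_zero_iff_of_nonneg
    (f := fun x : ℤ → Set.Icc (0 : ℝ) b => diagElem (gramOp x T) f 0)
    (fun x => cfcForm_nonneg (fun t _ => hf0 t) _)
    ((continuous_diagElem T hb hf 0).integrable_of_hasCompactSupport
      (HasCompactSupport.of_compactSpace _))).1 h
  exact (measurePreserving_shiftSeq μ n).quasiMeasurePreserving.ae h1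

theorem ae_spectrum_gramOp_eq_support (hT : IsAnalysis ψ T)
    (hshift : ∀ n m : ℤ, inner ℂ (ψ (n + 1)) (ψ (m + 1)) = inner ℂ (ψ n) (ψ m))
    (hint : ∀ f : ℝ → ℝ, Continuous f → Integrable f ν) :
    ∀ᵐ x ∂(Measure.infinitePi fun _ : ℤ => μ), spectrum ℝ (gramOp x T) = ν.support := by
  have h1 := ae_all_iff.2 fun p : ℚ => ae_all_iff.2 fun r : ℚ =>
    ae_tendsto_average_diagElem hb hνint (continuous_tent p r)
  have h2 : ∀ᵐ x ∂(Measure.infinitePi fun _ : ℤ => μ), ∀ p r : ℚ, ∫ t, tent p r t ∂ν = 0 →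
      ∀ n : ℤ, diagElem (gramOp (shiftSeq n x) T) (tent p r) 0 = 0 := by
    refine ae_all_iff.2 fun p => ae_all_iff.2 fun r => ?_
    by_cases h : ∫ t, tent p r t ∂ν = 0
    · filter_upwards [ae_all_iff.2 fun n : ℤ => ae_diagElem_eq_zero hb hνint (continuous_tent p r)
        (tent_nonneg p r) h n] with x hx _ using hx
    -- The hypothesis on the integral does not involve `x`, so tents with non-zero integral impose
    -- nothing.
    · exact .of_forall fun x h' => absurd h' h
  filter_upwards [h1, h2] with x h1 h2
  refine spectrum_eq_support (isSelfAdjoint_gramOp _ T) hint (fun p r => ?_) fun p r h n => ?_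
  · refine (h1 p r).congr fun N => ?_
    congr 1
    exact Finset.sum_congr rfl fun n _ =>
      (diagElem_shiftSeq hT hshift hb (continuous_tent p r) x n).symm
  · rw [diagElem_shiftSeq hT hshift hb (continuous_tent p r)]
    exact h2 p r h n

omit hνint [IsProbabilityMeasure μ] in
theorem tendsto_sum_finEigenvalues (hT : IsAnalysis ψ T) (hli : LinearIndependent ℂ ψ)
    (hshift : ∀ n m : ℤ, inner ℂ (ψ (n + 1)) (ψ (m + 1)) = inner ℂ (ψ n) (ψ m))
    (hνK : ν (Set.Icc 0 (b * ‖T‖ ^ 2))ᶜ = 0) {x : ℤ → Set.Icc (0 : ℝ) b}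
    (hx : ∀ n, 0 < (x n : ℝ)) {κ : ℤ → ℝ} (hκ : ∀ n, κ n = x n)
    (hmom : ∀ p : ℕ, Tendsto (fun N : ℕ => (2 * (N : ℝ) + 1)⁻¹ * ∑ n ∈ Finset.Icc (-(N : ℤ)) N,
      diagElem (gramOp (shiftSeq n x) T) (fun t => t ^ p) 0) atTop (𝓝 (∫ t, t ^ p ∂ν)))
    {f : ℝ → ℝ} (hf : Continuous f) :
    Tendsto (fun N : ℕ => (2 * (N : ℝ) + 1)⁻¹ * ∑ i, f (finEigenvalues ψ κ N i)) atTop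
      (𝓝 (∫ t, f t ∂ν)) := by
  refine tendsto_of_moments (fun N i => finEigenvalues_mem_Icc hT hb x hκ N i)
    (fun N => by positivity) (fun N => ?_) hνK (fun f hf => integrable_of_measure_compl_Icc hνK hf)
    (fun p => ?_) hf
  · rw [finrank_finRan hT hli hb hx hκ]
    push_cast
    exact inv_mul_cancel₀ (by positivity)
  · have hc : Continuous fun t : ℝ => t ^ p := continuous_pow p
    -- Covariance is applied to the truncated sequence, whose truncation depends on `N`; hence the
    -- edge estimate precedes it.
    refine (tendsto_average_truncate hb (continuous_diagElem T hb hc 0) (hmom p)).congr fun N => ?_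
    rw [sum_finEigenvalues_pow hT hli hb hx hκ]
    congr 1
    exact Finset.sum_congr rfl fun n _ => (diagElem_shiftSeq hT hshift hb hc _ n).symm

end DensityOfStates

end

end ProjSum

end

/-! ### The main theorem -/

open ContinuousLinearMap ProjSum in
theorem mainTheorem4 {H : Type*} [NormedAddCommGroup H] [InnerProductSpace ℂ H] [CompleteSpace H]
    (ψ : ℤ → H) (hnorm : ∀ n, ‖ψ n‖ = 1)
    (G : ProjSum.EllTwo →L[ℂ] ProjSum.EllTwo) (hG : ProjSum.IsGramOperator ψ G)
    (hshift : ∀ n m : ℤ, inner ℂ (ψ (n + 1)) (ψ (m + 1)) = inner ℂ (ψ n) (ψ m))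
    (P₀ : Measure ℝ) [IsProbabilityMeasure P₀]
    (hcompact : IsCompact P₀.support) (hpos : P₀.support ⊆ Set.Ioi 0) :
    let P : Measure (ℤ → ℝ) := Measure.infinitePi fun _ : ℤ => P₀
    -- the operators are well defined as strong limits, almost surely and for `κ = 1`
    (∀ᵐ κ ∂P, ∀ x : H,
      Tendsto (fun N : ℕ => ProjSum.finOp ψ κ N x) atTop (𝓝 (ProjSum.limOp ψ κ x))) ∧
    (∀ x : H, Tendsto (fun N : ℕ => ProjSum.finOp ψ (fun _ => 1) N x) atTop
      (𝓝 (ProjSum.limOp ψ (fun _ => 1) x))) ∧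
    ∃ (S : Set ℝ) (ν : Measure ℝ), IsProbabilityMeasure ν ∧
      -- `S` is the deterministic spectrum; it is the support of `ν`, once the kernels of `P_1` and `G` match
      (∀ᵐ κ ∂P, spectrum ℂ (ProjSum.limOp ψ κ) = Complex.ofReal '' S) ∧
      ((LinearMap.ker (ProjSum.limOp ψ (fun _ => 1) : H →ₗ[ℂ] H) = ⊥ ↔
          LinearMap.ker (G : ProjSum.EllTwo →ₗ[ℂ] ProjSum.EllTwo) = ⊥) → ν.support = S) ∧
      ν.support \ {0} = S \ {0} ∧
      (0 ∈ ν.support ↔ 0 ∈ spectrum ℂ G) ∧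
      ν (Set.Iio 0) = 0 ∧
      -- convergence, on a set of full measure that does not depend on `f`
      (∀ f : ℝ → ℝ, Continuous f → Integrable f ν) ∧
      (∀ᵐ κ ∂P, ∀ f : ℝ → ℝ, Continuous f →
        Tendsto (fun N : ℕ => ProjSum.normTrace ψ κ N f) atTop
          (𝓝 ((∫ t, f t ∂ν : ℝ) : ℂ)) ∧
        Tendsto (fun N : ℕ => ∫ t, f t ∂(ProjSum.countMeasure ψ κ N)) atTop
          (𝓝 (∫ t, f t ∂ν))) ∧
      -- moments
      Integrable (fun κ : ℤ → ℝ => κ 0 ^ 2) P ∧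
      Summable (fun m : ℤ => ‖ProjSum.symbolCoeff ψ m‖ ^ 2) ∧
      ∫ t, t ∂ν = ∫ κ, κ 0 ∂P ∧
      ∫ t, t ^ 2 ∂ν = variance (fun κ : ℤ → ℝ => κ 0) P +
        (∫ κ, κ 0 ∂P) ^ 2 * ∑' m : ℤ, ‖ProjSum.symbolCoeff ψ m‖ ^ 2 := by
  intro P
  obtain ⟨a, b, ha, hb1, hab⟩ := exists_Icc_of_isCompact_support hcompact hpos
  have hb : 0 ≤ b := zero_le_one.trans hb1
  obtain ⟨T, hT⟩ := exists_isAnalysis hG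
  have hli := linearIndependent_of_isGramOperator hnorm hG hshift
  -- Almost surely `κ` already takes its values in `[a, b]`, so clamping changes nothing and
  -- transfers the problem to a compact product space.
  set μ : Measure (Set.Icc (0 : ℝ) b) := P₀.map (Set.projIcc 0 b hb)
  have hμprob : IsProbabilityMeasure μ :=
    Measure.isProbabilityMeasure_map continuous_projIcc.measurable.aemeasurable
  set Q := Measure.infinitePi fun _ : ℤ => μ
  have hPQ : P.map (clamp hb) = Q := map_clamp hb P₀
  have hcm := measurable_clamp hb
  have hκ : ∀ᵐ κ ∂P, ∀ n, κ n ∈ Set.Icc a b := ae_all_iff.2 fun n =>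
    (measurePreserving_eval_infinitePi (fun _ : ℤ => P₀) n).quasiMeasurePreserving.ae hab
  have hcl : ∀ κ : ℤ → ℝ, (∀ n, κ n ∈ Set.Icc a b) → ∀ n, κ n = clamp hb κ n :=
    fun κ h => clamp_apply hb ha.le h
  have hcla : ∀ κ : ℤ → ℝ, (∀ n, κ n ∈ Set.Icc a b) → ∀ n, a ≤ clamp hb κ n :=
    fun κ h n => (h n).1.trans_eq (hcl κ h n)
  let x₁ : ℤ → Set.Icc (0 : ℝ) b := fun _ => ⟨1, zero_le_one, hb1⟩
  have hlim1 : limOp ψ (fun _ => 1) = sumOp x₁ T := limOp_eq x₁ hT fun _ => rfl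
  set K := b * ‖T‖ ^ 2
  have hK0 : 0 ≤ K := by positivity
  have hFcont : ∀ f : ℝ → ℝ, Continuous f →
      Continuous fun x : ℤ → Set.Icc (0 : ℝ) b => diagElem (gramOp x T) f 0 :=
    fun f hf => continuous_diagElem T hb hf 0
  obtain ⟨ν, hνprob, hνK, hνint⟩ := exists_average_spectralMeasure Q (fun x => gramOp x T)
    (fun x => isSelfAdjoint_gramOp x T) hK0 (fun x => spectrum_gramOp_subset T hb x)
    (norm_stdVec 0) hFcont
  change ∀ f : ℝ → ℝ, Continuous f → ∫ t, f t ∂ν = ∫ x, diagElem (gramOp x T) f 0 ∂Q at hνint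
  have hint : ∀ f : ℝ → ℝ, Continuous f → Integrable f ν :=
    fun f hf => integrable_of_measure_compl_Icc hνK hf
  have hspec : ∀ᵐ κ ∂P, spectrum ℝ (gramOp (clamp hb κ) T) = ν.support := by
    have h := ae_spectrum_gramOp_eq_support hb hνint hT hshift hint
    change ∀ᵐ x ∂Q, _ at h
    rw [← hPQ] at h
    exact ae_of_ae_map hcm.aemeasurable h
  -- Only monomials are needed here: they are countable, so the exceptional set does not depend on
  -- the continuous function tested later.
  have hmom : ∀ᵐ κ ∂P, ∀ p : ℕ, Tendsto (fun N : ℕ => (2 * (N : ℝ) + 1)⁻¹ *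
      ∑ n ∈ Finset.Icc (-(N : ℤ)) N,
        diagElem (gramOp (shiftSeq n (clamp hb κ)) T) (fun t => t ^ p) 0) atTop
      (𝓝 (∫ t, t ^ p ∂ν)) := by
    have h := ae_all_iff.2 fun p : ℕ => ae_tendsto_average_diagElem hb hνint (continuous_pow p)
    change ∀ᵐ x ∂Q, _ at h
    rw [← hPQ] at h
    exact ae_of_ae_map hcm.aemeasurable h
  have h0supp : 0 ∈ ν.support ↔ ¬ IsBddBelowOp (adjoint T) := by
    -- The claim is deterministic, so one good realisation of `κ` suffices.
    obtain ⟨κ, h1, h2⟩ := (hspec.and hκ).exists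
    rw [← h1, spectrum.zero_mem_iff, isUnit_gramOp_iff ha (hcla κ h2)]
  have hid : IdentDistrib (fun κ : ℤ → ℝ => κ 0) (fun t : Set.Icc (0 : ℝ) b => (t : ℝ)) P μ :=
    identDistrib_projIcc hb ha.le hab
  -- The deterministic spectrum is `supp ν` away from 0, with 0 adjoined exactly when `T` is not
  -- bounded below.
  refine ⟨?_, fun y => ?_, (ν.support \ {0}) ∪ {t | t = 0 ∧ ¬ IsBddBelowOp T}, ν, hνprob, ?_, ?_,
    ?_, ?_, ?_, hint, ?_, ?_, summable_symbolCoeff hT, ?_, ?_⟩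
  · filter_upwards [hκ] with κ h y
    rw [limOp_eq _ hT (hcl κ h)]
    exact tendsto_finOp _ hT (hcl κ h) y
  · rw [hlim1]
    exact tendsto_finOp x₁ hT (fun _ => rfl) y
  · filter_upwards [hκ, hspec] with κ h h1
    rw [limOp_eq _ hT (hcl κ h), spectrum_sumOp ha (hcla κ h), h1]
  · rw [hlim1, ker_sumOp_eq_bot_iff one_pos (fun _ => le_rfl), ker_gram_eq_bot_iff hG hshift hT]
    intro hker
    rw [isBddBelowOp_iff_adjoint hker, ← h0supp]
    ext t
    rcases eq_or_ne t 0 with rfl | ht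
    · simp
    · simp [ht]
  · ext t
    rcases eq_or_ne t 0 with rfl | ht
    · simp
    · simp [ht]
  · rw [h0supp, spectrum.zero_mem_iff, isUnit_gram_iff hG hshift hT]
  · refine measure_mono_null (t := (Set.Icc 0 K)ᶜ) (fun t ht h => ?_) hνK
    exact absurd h.1 (not_le.2 ht)
  · filter_upwards [hκ, hmom] with κ h hmom f hf
    have hconv := tendsto_sum_finEigenvalues hb hT hli hshift hνK
      (fun n => ha.trans_le (hcla κ h n)) (hcl κ h) hmom hf
    refine ⟨?_, ?_⟩
    · simp only [normTrace_eq ψ κ _ hf]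
      exact (Complex.continuous_ofReal.tendsto _).comp hconv
    · simpa only [integral_countMeasure] using hconv
  · refine Integrable.of_bound
      (by fun_prop : Measurable fun κ : ℤ → ℝ => κ 0 ^ 2).aestronglyMeasurable (b ^ 2) ?_
    filter_upwards [hκ] with κ h
    rw [norm_pow, Real.norm_of_nonneg (ha.le.trans (h 0).1)]
    exact pow_le_pow_left₀ (ha.le.trans (h 0).1) (h 0).2 2
  · rw [hνint _ continuous_id', hid.integral_eq]
    simp only [diagElem_gramOp_id hT hnorm]
    have h : MeasurePreserving (Function.eval 0) Q μ :=
      measurePreserving_eval_infinitePi (fun _ : ℤ => μ) 0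
    refine (integral_map h.measurable.aemeasurable
      measurable_subtype_coe.aestronglyMeasurable).symm.trans ?_
    rw [h.map_eq]
  · rw [hνint _ (by fun_prop), hid.integral_eq, hid.variance_eq]
    exact integral_diagElem_gramOp_sq hT hnorm μ
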